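/- **Trees and groups.** For $n\ge 0$ let $T_n$ be the ternary rooted tree with $n$ levels: its vertices at level $i\le n$ are the words $(\ell_1,\dots,\ell_i)$ with $\ell_j\in\{1,2,3\}$, the root is the empty word, and the parent of $(\ell_1,\dots,\ell_i)$ is $(\ell_1,\dots,\ell_{i-1})$. Let $\mathrm{Aut}(T_n)$ be the group of automorphisms of this rooted tree. For $a_1,a_2,a_3\in \mathrm{Aut}(T_{n-1})$ and $b\in\mathfrak S_3=\mathrm{Aut}(T_1)$ let $((a_1,a_2,a_3),b)\in\mathrm{Aut}(T_n)$ be the automorphism $(i,w)\mapsto (b(i),a_i(w))$, where $i\in\{1,2,3\}$ and $w$ is a vertex of $T_{n-1}$; this identifies $\mathrm{Aut}(T_n)$ with $\mathrm{Aut}(T_{n-1})\wr\mathfrak S_3$, and hence with the $n$-fold iterated wreath product $[\mathfrak S_3]^n$. For $n\ge 2$ let $\mathrm{sgn}_2:\mathrm{Aut}(T_n)\to\{\pm1\}$ be the sign of the induced permutation of the nine vertices at level $2$. Define $E_1=\mathrm{Aut}(T_1)$ and, for $n\ge 2$, $$E_n=\{((a_1,a_2,a_3),b): a_1,a_2,a_3\in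 E_{n-1},\ b\in\mathfrak S_3\}\cap\ker(\mathrm{sgn}_2)\subset \mathrm{Aut}(T_n).$$ Let $\mathrm{Aut}(T_\infty)=\varprojlim \mathrm{Aut}(T_n)$ and $E_\infty=\varprojlim E_n\subset \mathrm{Aut}(T_\infty)$, the limits being taken along the restriction maps. Equip $\mathrm{Aut}(T_\infty)$ with the metric $d(\sigma,\tau)=\inf\{1/|\mathrm{Aut}(T_n)| : \sigma|_{T_n}=\tau|_{T_n}\}$. **Theorem.** Let $K$ be a number field, let $f(z)=-2z^3+3z^2\in K[z]$, with $n$-th iterate $f^n$, and let $x\in K$. Suppose there exist primes $\mathfrak p$ and $\mathfrak q$ of $K$ lying over $2$ and $3$, respectively, such that $v_{\mathfrak q}(x)=1$, and either $v_{\mathfrak p}(x)=\pm1$ or $v_{\mathfrak p}(1-x)=1$. Then for each $n\ge1$: 1. The polynomial $f^n(z)-x$ is irreducible over $K$, and it is Eisenstein at $\mathfrak q$ (that is, with respect to the maximal ideal of the valuation ring of $v_{\mathfrak q}$). 2. $\mathrm{Gal}(f^n(z)-x/K)\cong E_n$ as groups acting on $T_n$. That is, if $K_n$ is the splitting field of $f^n(z)-x$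 over $K$, then there are a map $\lambda$ from the vertices of $T_n$ to $K_n$ that sends the vertices of level $i$ bijectively onto $f^{-i}(x)=\{y\in K_n: f^i(y)=x\}$ for every $0\le i\le n$ and satisfies $\lambda(\text{parent of }v)=f(\lambda(v))$ for every $v$ other than the root, and a group isomorphism $e:\mathrm{Gal}(K_n/K)\to E_n$ with $\lambda(e(s)v)=s(\lambda(v))$ for all $s\in \mathrm{Gal}(K_n/K)$ and all vertices $v$. Moreover, the Hausdorff dimension of $E_\infty$ in $\mathrm{Aut}(T_\infty)$ is $$\dim_H(E_\infty)=\lim_{n\to\infty}\frac{\log|E_n|}{\log|\mathrm{Aut}(T_n)|}=1-\frac13\,\frac{\log 2}{\log 6}.$$ -/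

import Mathlib

open Polynomial Filter Topology
open scoped NumberField ENNReal

universe u

/-! ### The regular ternary rooted tree and its automorphisms -/

namespace TernaryTree

/-- The vertices of the ternary rooted tree `T_n`: words of length at most `n` in three letters.
The length of a word is the level of the vertex, and the root is the empty word. -/
abbrev Vertex (n : ℕ) : Type := {v : List (Fin 3) // v.length ≤ n}

namespace Vertex

/-- The root of `T_n`. -/
def root (n : ℕ) : Vertex n := ⟨[], Nat.zero_le n⟩

/-- The level of a vertex, that is, its distance from the root. -/
def level {n : ℕ} (v : Vertex n) : ℕ := v.1.length

/-- The parent of a vertex, obtained by deleting the last letter; by convention the root is its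
own parent. The edges of `T_n` join the non-root vertices to their parents. -/
def parent {n : ℕ} (v : Vertex n) : Vertex n :=
  ⟨v.1.dropLast, by have := v.2; simp only [List.length_dropLast]; omega⟩

/-- The vertex of `T_{n+1}` labelled `(i, w)`, which corresponds to `w` in the copy of `T_n`
that sits above the level-one vertex `i`. -/
def cons {n : ℕ} (i : Fin 3) (w : Vertex n) : Vertex (n + 1) :=
  ⟨i :: w.1, by have := w.2; simp only [List.length_cons]; omega⟩

/-- The inclusion of `T_m` in `T_n` for `m ≤ n`. -/
def incl {m n : ℕ} (h : m ≤ n) (v : Vertex m) : Vertex n := ⟨v.1, v.2.trans h⟩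

end Vertex

open Vertex

/-- `Aut(T_n)`: the permutations of the vertices that respect the parent relation
(so they fix the root and preserve levels and edges). -/
def treeAut (n : ℕ) : Subgroup (Equiv.Perm (Vertex n)) where
  carrier := {σ | ∀ v, σ (parent v) = parent (σ v)}
  mul_mem' := by
    intro σ τ hσ hτ v
    simp only [Equiv.Perm.mul_apply]
    rw [hτ v, hσ (τ v)]
  one_mem' := by intro v; rfl
  inv_mem' := by
    intro σ hσ v
    rw [Equiv.Perm.inv_eq_iff_eq, hσ]
    exact congrArg parent (σ.apply_symm_apply v).symm

lemma parent_eq_self_iff {n : ℕ} (v : Vertex n) : parent v = v ↔ v = root n := by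
  obtain ⟨l, hl⟩ := v
  simp only [parent, root, Subtype.mk.injEq]
  constructor
  · intro h
    have h' := congrArg List.length h
    rw [List.length_dropLast] at h'
    exact List.length_eq_zero_iff.mp (by omega)
  · rintro rfl; rfl

lemma treeAut_root {n : ℕ} (σ : treeAut n) : σ.1 (root n) = root n := by
  rw [← parent_eq_self_iff, ← σ.2, (parent_eq_self_iff _).2 rfl]

lemma level_parent {n : ℕ} (v : Vertex n) : (parent v).level = v.level - 1 := by
  simp [parent, level]

lemma level_eq_zero_iff {n : ℕ} (v : Vertex n) : v.level = 0 ↔ v = root n := by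
  obtain ⟨l, hl⟩ := v
  simp [level, root]

/-- Tree automorphisms preserve levels. -/
lemma level_treeAut {n : ℕ} (σ : treeAut n) (v : Vertex n) : (σ.1 v).level = v.level := by
  induction hk : v.level generalizing v with
  | zero =>
    rw [(level_eq_zero_iff v).1 hk, treeAut_root, level_eq_zero_iff]
  | succ k ih =>
    have h1 := ih (parent v) (by rw [level_parent, hk]; rfl)
    rw [σ.2 v, level_parent] at h1
    have h2 : (σ.1 v).level ≠ 0 := by
      intro h
      rw [level_eq_zero_iff, ← treeAut_root σ, σ.1.injective.eq_iff, ← level_eq_zero_iff] at h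
      omega
    omega

/-- The restriction of a tree automorphism to the vertices of level at most `m`, as a map. -/
def restrictFun {m n : ℕ} (h : m ≤ n) (σ : treeAut n) (v : Vertex m) : Vertex m :=
  ⟨(σ.1 (incl h v)).1, (level_treeAut σ (incl h v)).le.trans v.2⟩

/-- The restriction homomorphism `π_m : Aut(T_n) → Aut(T_m)` for `m ≤ n`. -/
def restrict {m n : ℕ} (h : m ≤ n) : treeAut n →* treeAut m where
  toFun σ :=
    ⟨{ toFun := restrictFun h σ
       invFun := restrictFun h σ⁻¹
       left_inv := fun v => by
         apply Subtype.ext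
         exact congrArg (fun u : Vertex n => u.1) (σ.1.symm_apply_apply (incl h v))
       right_inv := fun v => by
         apply Subtype.ext
         exact congrArg (fun u : Vertex n => u.1) (σ.1.apply_symm_apply (incl h v)) },
     fun v => by
       apply Subtype.ext
       exact congrArg (fun u : Vertex n => u.1) (σ.2 (incl h v))⟩
  map_one' := rfl
  map_mul' _ _ := rfl

/-- The leaves of `T_n`: the vertices of level `n`. -/
abbrev Leaf (n : ℕ) : Type := {v : Vertex n // v.level = n}

noncomputable instance (n : ℕ) : Fintype (Vertex n) :=
  haveI : Finite (Vertex n) := (List.finite_length_le (Fin 3) n).to_subtype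
  Fintype.ofFinite _

/-- The action of `Aut(T_n)` on the leaves of `T_n`. -/
def leafPerm (n : ℕ) : treeAut n →* Equiv.Perm (Leaf n) where
  toFun σ := σ.1.subtypePerm (fun v => by rw [level_treeAut])
  map_one' := rfl
  map_mul' _ _ := rfl

/-- The sign of a tree automorphism as a permutation of the leaves. -/
noncomputable def sgn (n : ℕ) : treeAut n →* ℤˣ := Equiv.Perm.sign.comp (leafPerm n)

/-- `sgn_m = sgn ∘ π_m`: the sign of the action on the vertices of level `m`. -/
noncomputable def sgnAt {m n : ℕ} (h : m ≤ n) : treeAut n →* ℤˣ := (sgn m).comp (restrict h)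

/-! ### The wreath product decomposition `Aut(T_{n+1}) ≅ Aut(T_n) ≀ 𝔖₃` -/

/-- The underlying map of `((a₁, a₂, a₃), b)`: it sends the vertex `(i, w)` to `(b i, a_i w)`. -/
def joinFun {n : ℕ} (a : Fin 3 → Equiv.Perm (Vertex n)) (b : Equiv.Perm (Fin 3)) :
    Vertex (n + 1) → Vertex (n + 1)
  | ⟨[], _⟩ => root (n + 1)
  | ⟨i :: w, h⟩ => cons (b i) (a i ⟨w, Nat.le_of_succ_le_succ h⟩)

lemma vertex_cases {n : ℕ} (v : Vertex (n + 1)) :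
    v = root (n + 1) ∨ ∃ i w, v = cons i w := by
  obtain ⟨_ | ⟨i, w⟩, h⟩ := v
  · exact Or.inl rfl
  · exact Or.inr ⟨i, ⟨w, Nat.le_of_succ_le_succ h⟩, rfl⟩

@[simp] lemma joinFun_root {n : ℕ} (a : Fin 3 → Equiv.Perm (Vertex n)) (b : Equiv.Perm (Fin 3)) :
    joinFun a b (root (n + 1)) = root (n + 1) := rfl

@[simp] lemma joinFun_cons {n : ℕ} (a : Fin 3 → Equiv.Perm (Vertex n)) (b : Equiv.Perm (Fin 3))
    (i : Fin 3) (w : Vertex n) : joinFun a b (cons i w) = cons (b i) (a i w) := rfl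

lemma parent_cons {n : ℕ} (i : Fin 3) (w : Vertex n) :
    (w = root n ∧ parent (cons i w) = root (n + 1)) ∨
      (w ≠ root n ∧ parent (cons i w) = cons i (parent w)) := by
  obtain ⟨_ | ⟨j, w⟩, h⟩ := w
  · exact Or.inl ⟨rfl, rfl⟩
  · exact Or.inr ⟨by simp [root], rfl⟩

/-- The element `((a₁, a₂, a₃), b)` of `Aut(T_{n+1})` given by `a₁, a₂, a₃ ∈ Aut(T_n)` and
`b ∈ 𝔖₃`. It fixes the root and sends the vertex `(i, w)` to `(b i, a_i w)`. -/
def join {n : ℕ} (a : Fin 3 → treeAut n) (b : Equiv.Perm (Fin 3)) : treeAut (n + 1) :=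
  ⟨{ toFun := joinFun (fun i => (a i).1) b
     invFun := joinFun (fun i => (a (b⁻¹ i)).1⁻¹) b⁻¹
     left_inv := fun v => by
       rcases vertex_cases v with rfl | ⟨i, w, rfl⟩ <;> simp
     right_inv := fun v => by
       rcases vertex_cases v with rfl | ⟨i, w, rfl⟩ <;> simp },
   fun v => by
     change joinFun _ _ _ = parent (joinFun _ _ _)
     rcases vertex_cases v with rfl | ⟨i, w, rfl⟩
     · rfl
     · rw [joinFun_cons]
       rcases parent_cons i w with ⟨rfl, h⟩ | ⟨hw, h⟩
       · rw [h, treeAut_root]; rfl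
       · rw [h, joinFun_cons, (a i).2]
         rcases parent_cons (b i) ((a i).1 w) with ⟨h', _⟩ | ⟨_, h'⟩
         · exact absurd ((a i).1.injective (h'.trans (treeAut_root (a i)).symm)) hw
         · exact h'.symm⟩

lemma join_apply_root {n : ℕ} (a : Fin 3 → treeAut n) (b : Equiv.Perm (Fin 3)) :
    (join a b).1 (root (n + 1)) = root (n + 1) := rfl

lemma join_apply_cons {n : ℕ} (a : Fin 3 → treeAut n) (b : Equiv.Perm (Fin 3))
    (i : Fin 3) (w : Vertex n) : (join a b).1 (cons i w) = cons (b i) ((a i).1 w) := rfl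

lemma treeAut_ext {n : ℕ} {σ τ : treeAut (n + 1)}
    (h : ∀ i w, σ.1 (cons i w) = τ.1 (cons i w)) : σ = τ := by
  refine Subtype.ext (Equiv.ext fun v => ?_)
  rcases vertex_cases v with rfl | ⟨i, w, rfl⟩
  · rw [treeAut_root, treeAut_root]
  · exact h i w

lemma join_mul {n : ℕ} (a a' : Fin 3 → treeAut n) (b b' : Equiv.Perm (Fin 3)) :
    join a b * join a' b' = join (fun i => a (b' i) * a' i) (b * b') :=
  treeAut_ext fun _ _ => rfl

lemma join_one {n : ℕ} : join (fun _ => (1 : treeAut n)) 1 = 1 :=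
  treeAut_ext fun _ _ => rfl

lemma join_inv {n : ℕ} (a : Fin 3 → treeAut n) (b : Equiv.Perm (Fin 3)) :
    (join a b)⁻¹ = join (fun i => (a (b⁻¹ i))⁻¹) b⁻¹ :=
  treeAut_ext fun _ _ => rfl

/-- The subgroup `H ≀ Aut(T_1) = {((a₁, a₂, a₃), b) : a_i ∈ H, b ∈ 𝔖₃}` of `Aut(T_{n+1})`
attached to a subgroup `H` of `Aut(T_n)`. -/
def wreath {n : ℕ} (H : Subgroup (treeAut n)) : Subgroup (treeAut (n + 1)) where
  carrier := {σ | ∃ (a : Fin 3 → treeAut n) (b : Equiv.Perm (Fin 3)),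
    (∀ i, a i ∈ H) ∧ σ = join a b}
  mul_mem' := by
    rintro _ _ ⟨a, b, ha, rfl⟩ ⟨a', b', ha', rfl⟩
    exact ⟨_, _, fun i => H.mul_mem (ha (b' i)) (ha' i), join_mul a a' b b'⟩
  one_mem' := ⟨_, _, fun _ => H.one_mem, join_one.symm⟩
  inv_mem' := by
    rintro _ ⟨a, b, ha, rfl⟩
    exact ⟨_, _, fun i => H.inv_mem (ha (b⁻¹ i)), join_inv a b⟩

/-- The groups `E_n ⊆ Aut(T_n)`: `E_1 = Aut(T_1)` and `E_n = (E_{n-1} ≀ Aut(T_1)) ∩ ker(sgn_2)`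
for `n ≥ 2` (for `n = 0`, the trivial group `Aut(T_0)`). -/
noncomputable def E : (n : ℕ) → Subgroup (treeAut n)
  | 0 => ⊤
  | 1 => ⊤
  | n + 2 => wreath (E (n + 1)) ⊓ (sgnAt (Nat.le_add_left 2 n)).ker

/-! ### The inverse limits and the metric on `Aut(T_∞)` -/

/-- The compatible families in `∏ Aut(T_n)`. -/
def compatibleFamilies : Subgroup (∀ n, treeAut n) where
  carrier := {σ | ∀ (m n : ℕ) (h : m ≤ n), restrict h (σ n) = σ m}
  mul_mem' := by
    intro σ τ hσ hτ m n h
    simp only [Pi.mul_apply, map_mul]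
    rw [hσ m n h, hτ m n h]
  one_mem' := by
    intro m n h
    simp only [Pi.one_apply, map_one]
  inv_mem' := by
    intro σ hσ m n h
    simp only [Pi.inv_apply, map_inv]
    rw [hσ m n h]

/-- `Aut(T_∞)`, the inverse limit of the groups `Aut(T_n)` along the restriction maps. -/
def TreeAutInf : Type := compatibleFamilies

instance : Group TreeAutInf := inferInstanceAs (Group compatibleFamilies)

/-- The restriction homomorphism `Aut(T_∞) → Aut(T_n)`. -/
def proj (n : ℕ) : TreeAutInf →* treeAut n :=
  (Pi.evalMonoidHom (fun n => treeAut n) n).comp compatibleFamilies.subtype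

/-- `E_∞`, the inverse limit of the groups `E_n`, as a subgroup of `Aut(T_∞)`. -/
noncomputable def EInf : Subgroup TreeAutInf := ⨅ n, (E n).comap (proj n)

lemma proj_restrict (σ : TreeAutInf) {m n : ℕ} (h : m ≤ n) :
    restrict h (proj n σ) = proj m σ := σ.2 m n h

lemma proj_ext {σ τ : TreeAutInf} (h : ∀ n, proj n σ = proj n τ) : σ = τ :=
  Subtype.ext (funext h)

lemma join_injective {n : ℕ} {a a' : Fin 3 → treeAut n} {b b' : Equiv.Perm (Fin 3)}
    (h : join a b = join a' b') : a = a' ∧ b = b' := by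
  have key : ∀ i w, cons (b i) ((a i).1 w) = cons (b' i) ((a' i).1 w) := fun i w => by
    rw [← join_apply_cons, ← join_apply_cons, h]
  have key' : ∀ i w, b i = b' i ∧ (a i).1 w = (a' i).1 w := fun i w => by
    have := congrArg Subtype.val (key i w)
    simp only [cons, List.cons.injEq] at this
    exact ⟨this.1, Subtype.ext this.2⟩
  exact ⟨funext fun i => Subtype.ext (Equiv.ext fun w => (key' i w).2),
    Equiv.ext fun i => (key' i (root n)).1⟩

lemma card_treeAut_strictMono : StrictMono (fun n => Nat.card (treeAut n)) := by
  refine strictMono_nat_of_lt_succ fun n => ?_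
  have hinj : Function.Injective
      (fun p : treeAut n × Equiv.Perm (Fin 3) => join (fun _ => p.1) p.2) := by
    rintro ⟨a, b⟩ ⟨a', b'⟩ h
    obtain ⟨h1, h2⟩ := join_injective h
    exact Prod.ext (congrFun h1 0) h2
  have := Nat.card_le_card_of_injective _ hinj
  rw [Nat.card_prod, Nat.card_perm, Nat.card_fin] at this
  simp only [Nat.factorial] at this
  have hpos : 0 < Nat.card (treeAut n) := Nat.card_pos
  omega

/-- The standard (Barnea-Shalev) metric of the profinite group `Aut(T_∞)` with respect to the
kernels `G_n` of the restriction maps `Aut(T_∞) → Aut(T_n)`, namely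
`d(σ, τ) = inf {1 / |Aut(T_n)| : σ and τ agree on T_n}`. -/
noncomputable instance : EMetricSpace TreeAutInf where
  edist σ τ := ⨅ (n : ℕ) (_ : proj n σ = proj n τ), ((Nat.card (treeAut n) : ℕ) : ℝ≥0∞)⁻¹
  edist_self σ := by
    refine le_antisymm (le_of_forall_gt fun c hc => ?_) zero_le
    obtain ⟨n, hn⟩ := ENNReal.exists_inv_nat_lt hc.ne'
    refine lt_of_le_of_lt (iInf_le_of_le n (iInf_le_of_le rfl ?_)) hn
    rw [ENNReal.inv_le_inv]
    exact_mod_cast card_treeAut_strictMono.le_apply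
  edist_comm σ τ := by simp only [eq_comm]
  edist_triangle σ τ ρ := by
    by_contra! hlt
    obtain ⟨n, m, hn, hm, hlt⟩ : ∃ n m, proj n σ = proj n τ ∧ proj m τ = proj m ρ ∧
        ((Nat.card (treeAut n) : ℕ) : ℝ≥0∞)⁻¹ + ((Nat.card (treeAut m) : ℕ) : ℝ≥0∞)⁻¹ <
        ⨅ (n : ℕ) (_ : proj n σ = proj n ρ), ((Nat.card (treeAut n) : ℕ) : ℝ≥0∞)⁻¹ := by
      by_contra! hcon
      refine absurd hlt (not_lt.2 ?_)
      simp only [ENNReal.iInf_add, ENNReal.add_iInf]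
      exact le_iInf₂ fun m hm => le_iInf₂ fun n hn => hcon n m hn hm
    rcases le_total n m with h | h
    · refine absurd hlt (not_lt.2 ((iInf₂_le n ?_).trans le_self_add))
      rw [hn, ← proj_restrict τ h, hm, proj_restrict ρ h]
    · refine absurd hlt (not_lt.2 ((iInf₂_le m ?_).trans le_add_self))
      rw [← hm, ← proj_restrict σ h, hn, proj_restrict τ h]
  eq_of_edist_eq_zero {σ τ} h := by
    refine proj_ext fun m => ?_
    by_contra hne
    have hpos : (0 : ℝ≥0∞) < ((Nat.card (treeAut m) : ℕ) : ℝ≥0∞)⁻¹ :=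
      ENNReal.inv_pos.2 (ENNReal.natCast_ne_top _)
    refine absurd h (lt_of_lt_of_le hpos (le_iInf₂ fun n hn => ?_)).ne'
    rw [ENNReal.inv_le_inv]
    have hnm : n ≤ m := by
      by_contra! hmn
      exact hne (by rw [← proj_restrict σ hmn.le, hn, proj_restrict τ hmn.le])
    exact_mod_cast card_treeAut_strictMono.monotone hnm

end TernaryTree

/-! ### The polynomial, its iterates and its preimage trees -/

namespace CubicPCF

/-- The polynomial `f(z) = -2z³ + 3z²`. -/
noncomputable def f (R : Type u) [CommRing R] : R[X] := -2 * X ^ 3 + 3 * X ^ 2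

/-- The polynomial `f^n(z) - x`, where `f^n` is the `n`-th iterate of `f`. -/
noncomputable def iterSub {R : Type u} [CommRing R] (n : ℕ) (x : R) : R[X] :=
  (f R).comp^[n] X - C x

/-- `lab` identifies the tree `T_n` with the tree of iterated preimages of `x` under `f` in `L`
of height at most `n`: it maps the vertices of level `i` bijectively onto
`f^{-i}(x) = {y : f^i(y) = x}`, and the parent of a non-root vertex labelled `y` is
labelled `f(y)`. -/
structure IsTreeLabelling {L : Type u} [CommRing L] (n : ℕ) (x : L)
    (lab : TernaryTree.Vertex n → L) : Prop where
  bijOn : ∀ i ≤ n, Set.BijOn lab {v | v.level = i} {y | (fun z => (f L).eval z)^[i] y = x}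
  parent : ∀ v, v ≠ TernaryTree.Vertex.root n → lab v.parent = (f L).eval (lab v)

/-- `v_P(x) = k` for the normalized discrete valuation `v_P` of the prime `P`. -/
def HasOrd {K : Type u} [Field K] [NumberField K]
    (P : IsDedekindDomain.HeightOneSpectrum (𝓞 K)) (x : K) (k : ℤ) : Prop :=
  P.valuation K x = WithZero.exp (-k)

/-- A polynomial over `K` is Eisenstein at the prime `P` if it has coefficients in the valuation
ring of `P` and is Eisenstein there with respect to the maximal ideal. -/
def IsEisensteinAtPrime {K : Type u} [Field K] [NumberField K]
    (P : IsDedekindDomain.HeightOneSpectrum (𝓞 K)) (g : K[X]) : Prop :=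
  ∃ G : (P.valuation K).valuationSubring[X],
    G.map (algebraMap (P.valuation K).valuationSubring K) = g ∧
      G.IsEisensteinAt (IsLocalRing.maximalIdeal (P.valuation K).valuationSubring)

end CubicPCF

/-! ### Wreath decomposition, signs and solvability -/

namespace TernaryTree

open Vertex

/-! Both critical points `0` and `1` of `f` are fixed. Hence, for the fibre `y` above `x`, the
squared Vandermonde determinant is `(27/4) x(1-x)`, while `4 ∏ yᵢ(1-yᵢ) = x(1-x)`. Multiplying the
determinants of `y` and of the three fibres above the `yᵢ` therefore gives `±(729/32) x(1-x)`, which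
is rational over the base. Labels are chosen so that this sign is `+` at every vertex where two
further levels exist (`exists_isOriented`). Applying a Galois automorphism to these relations shows
that it acts through `E n` (`exists_treeAut`).

For the converse, the group theory is `E_le_of_stabilizer`. A subgroup of `E (n + 2)` is everything
as soon as it surjects onto `𝔖₃`, the stabilizer of some level-one vertex `j` induces all of `E (n +
1)` above `j`, and some element of that stabilizer has a sign on the children of `j` different from
its sign on level one. This rests on the fact that the kernel of the level-one sign on `E (n + 1)`
is the commutator subgroup (`mem_commutator_E`), combined with a Goursat argument for solvable
groups.

The arithmetic supplies the three inputs. Modulo a prime above `3`, `f` is `z³`, so the iterates are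
Eisenstein and the action is transitive. At a prime above `2`, `3x(1-x)` is not a square, which
gives an odd permutation. Some preimage `y` of `x` satisfies the same hypotheses over `K(y)`
(`IsAdmissible.exists_preimage`), so induction over varying base fields applies. Over `K(y)` the
product `x(1-x)y(1-y)` is not a square, which separates the two signs.

For the dimension, `|E n|` is `2^(1/3) |Aut(T_n)|^d` for `n ≥ 1`, where `d` is the asserted value.
Covering by cylinders bounds the dimension above. Nested intervals give a `d`-Hölder map of `E_∞`
whose image contains `[0, 1)`, which bounds it below. -/

lemma exists_eq_join {n : ℕ} (σ : treeAut (n + 1)) :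
    ∃ (a : Fin 3 → treeAut n) (b : Equiv.Perm (Fin 3)), σ = join a b := by
  -- The first letter of the image of `(i, w)` depends on `i` alone, by induction on the level of
  -- `w` through parents. The default letter `0` never intervenes, since the image is not the root.
  have key : ∀ (τ : treeAut (n + 1)) (i : Fin 3) (w : Vertex n),
      ∃ w' : Vertex n, τ.1 (cons i w) = cons ((τ.1 (cons i w)).1.headD 0) w' ∧
        (τ.1 (cons i w)).1.headD 0 = (τ.1 (cons i (root n))).1.headD 0 := by
    intro τ i w
    induction hk : w.level generalizing w with
    | zero =>
      rw [level_eq_zero_iff] at hk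
      subst hk
      rcases vertex_cases (τ.1 (cons i (root n))) with h | ⟨j, w', h⟩
      · have := level_treeAut τ (cons i (root n))
        rw [h] at this
        simp [level, cons, root] at this
      · exact ⟨w', by rw [h]; rfl, rfl⟩
    | succ k ih =>
      have hw : w ≠ root n := fun h => by rw [h] at hk; simp [level, root] at hk
      rcases parent_cons i w with ⟨h, _⟩ | ⟨-, hp⟩
      · exact absurd h hw
      obtain ⟨w1, -, h2⟩ := ih (parent w) (by rw [level_parent, hk]; rfl)
      rw [← hp, τ.2] at h2
      rcases vertex_cases (τ.1 (cons i w)) with h | ⟨j, w', h⟩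
      · have := level_treeAut τ (cons i w)
        rw [h] at this
        simp [level, cons, root] at this
      · refine ⟨w', by rw [h]; rfl, ?_⟩
        rw [← h2, h]
        have hw' : w' ≠ root n := fun h' => by
          have := level_treeAut τ (cons i w)
          rw [h, h'] at this
          simp only [level, cons, root, List.length_cons, List.length_nil] at this hk
          omega
        rcases parent_cons j w' with ⟨h', _⟩ | ⟨-, hp'⟩
        · exact absurd h' hw'
        · rw [hp']; rfl
  have key' : ∀ (τ : treeAut (n + 1)), ∃ (c : Fin 3 → Fin 3) (g : Fin 3 → Vertex n → Vertex n),
      ∀ i w, τ.1 (cons i w) = cons (c i) (g i w) := by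
    intro τ
    choose g hg using key τ
    exact ⟨fun i => (τ.1 (cons i (root n))).1.headD 0, g, fun i w => by
      dsimp only; rw [← (hg i w).2]; exact (hg i w).1⟩
  obtain ⟨c, g, h⟩ := key' σ
  obtain ⟨c', g', h'⟩ := key' σ⁻¹
  have cinj : ∀ {i j : Fin 3} {v w : Vertex n}, cons i v = cons j w → i = j ∧ v = w := by
    intro i j v w e
    have := congrArg Subtype.val e
    simp only [cons, List.cons.injEq] at this
    exact ⟨this.1, Subtype.ext this.2⟩
  have h1 : ∀ i w, c' (c i) = i ∧ g' (c i) (g i w) = w := fun i w => by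
    refine cinj ?_
    rw [← h', ← h]
    exact σ.1.symm_apply_apply _
  have h2 : ∀ i w, c (c' i) = i ∧ g (c' i) (g' i w) = w := fun i w => by
    refine cinj ?_
    rw [← h, ← h']
    exact σ.1.apply_symm_apply _
  refine ⟨fun i => ⟨⟨g i, g' (c i), fun w => (h1 i w).2, fun w => ?_⟩, fun w => ?_⟩,
    ⟨c, c', fun i => (h1 i (root n)).1, fun i => (h2 i (root n)).1⟩, treeAut_ext fun i w => h i w⟩
  · have := (h2 (c i) w).2
    rwa [(h1 i w).1] at this
  · change g i (parent w) = parent (g i w)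
    have hroot : g i (root n) = root n := by
      have := level_treeAut σ (cons i (root n))
      rw [h] at this
      rw [← level_eq_zero_iff]
      simpa [level, cons, root] using this
    have hroot' : ∀ w, g i w = root n → w = root n := fun w hw => by
      rw [← (h1 i w).2, hw]; nth_rw 1 [← hroot]; exact (h1 i _).2
    by_cases hw : w = root n
    · subst hw
      rw [(parent_eq_self_iff _).2 rfl, hroot, (parent_eq_self_iff _).2 rfl]
    · have e := σ.2 (cons i w)
      rw [((parent_cons i w).resolve_left fun h => hw h.1).2, h, h,
        ((parent_cons (c i) (g i w)).resolve_left fun h => hw (hroot' w h.1)).2] at e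
      exact (cinj e).2

lemma restrict_join {m n : ℕ} (h : m ≤ n) (a : Fin 3 → treeAut n) (b : Equiv.Perm (Fin 3)) :
    restrict (Nat.succ_le_succ h) (join a b) = join (fun i => restrict h (a i)) b :=
  treeAut_ext fun _ _ => rfl

/-- A leaf of `T_{n+1}` is a letter followed by a leaf of `T_n`. -/
def leafEquiv (n : ℕ) : Fin 3 × Leaf n ≃ Leaf (n + 1) where
  toFun p := ⟨cons p.1 p.2.1, by have := p.2.2; simp only [level, cons] at *; simpa using this⟩
  invFun v := (v.1.1.head (fun h => by have := v.2; simp [level, h] at this),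
    ⟨⟨v.1.1.tail, by have := v.2; simp only [level] at this; simp; omega⟩,
      by have := v.2; simp only [level] at *; simp; omega⟩)
  left_inv _ := rfl
  right_inv v := Subtype.ext (Subtype.ext (List.cons_head_tail _))

lemma odd_card_leaf (n : ℕ) : Odd (Nat.card (Leaf n)) := by
  induction n with
  | zero =>
    have : Unique (Leaf 0) :=
      ⟨⟨⟨root 0, rfl⟩⟩, fun v => Subtype.ext ((level_eq_zero_iff _).1 v.2)⟩
    simp
  | succ n ih =>
    rw [← Nat.card_congr (leafEquiv n), Nat.card_prod, Nat.card_fin]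
    exact Odd.mul (by decide) ih

/-- On leaves the automorphism is a block-diagonal permutation followed by one copy of `b` for each
leaf of `T_n`. The number of these copies is odd, so together they contribute `b.sign`. -/
lemma sgn_join {n : ℕ} (a : Fin 3 → treeAut n) (b : Equiv.Perm (Fin 3)) :
    sgn (n + 1) (join a b) = b.sign * ∏ i, sgn n (a i) := by
  classical
  have h : leafPerm (n + 1) (join a b) = (leafEquiv n).permCongr
      (Equiv.prodCongrLeft (fun _ => b) * Equiv.prodCongrRight fun i => leafPerm n (a i)) := by
    ext1 v
    obtain ⟨⟨i, w⟩, rfl⟩ := (leafEquiv n).surjective v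
    simp only [Equiv.permCongr_apply, Equiv.symm_apply_apply]
    rfl
  have hodd : ∀ u : ℤˣ, ∀ k : ℕ, Odd k → u ^ k = u := fun u k hk => by
    obtain ⟨m, rfl⟩ := hk
    rw [pow_succ, pow_mul, Int.units_sq, one_pow, one_mul]
  simp only [sgn, MonoidHom.comp_apply]
  rw [h, Equiv.Perm.sign_permCongr, Equiv.Perm.sign_mul, Equiv.Perm.sign_prodCongrLeft, Equiv.Perm.sign_prodCongrRight,
    Finset.prod_const, Finset.card_univ, ← Nat.card_eq_fintype_card, hodd _ _ (odd_card_leaf n)]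

lemma sgn_zero (a : treeAut 0) : sgn 0 a = 1 := by
  have : Subsingleton (Leaf 0) := ⟨fun v w => Subtype.ext
    (((level_eq_zero_iff _).1 v.2).trans ((level_eq_zero_iff _).1 w.2).symm)⟩
  have : leafPerm 0 a = 1 := Subsingleton.elim _ _
  simp [sgn, this]

/-- The sign of the action on the level-one vertices. -/
noncomputable abbrev sgnOne (n : ℕ) : treeAut (n + 1) →* ℤˣ := sgnAt (Nat.le_add_left 1 n)

lemma sgnOne_join {n : ℕ} (a : Fin 3 → treeAut n) (b : Equiv.Perm (Fin 3)) :
    sgnOne n (join a b) = b.sign := by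
  have : restrict (Nat.le_add_left 1 n) (join a b) = join (fun i => restrict n.zero_le (a i)) b :=
    restrict_join n.zero_le a b
  simp [sgnAt, this, sgn_join, sgn_zero]

lemma sgnAt_two_join {n : ℕ} (a : Fin 3 → treeAut (n + 1)) (b : Equiv.Perm (Fin 3)) :
    sgnAt (Nat.le_add_left 2 n) (join a b) = b.sign * ∏ i, sgnOne n (a i) := by
  have : restrict (Nat.le_add_left 2 n) (join a b) =
    join (fun i => restrict (Nat.le_add_left 1 n) (a i)) b := restrict_join _ a b
  simp [sgnAt, this, sgn_join]

lemma join_mem_wreath {n : ℕ} {H : Subgroup (treeAut n)} {a : Fin 3 → treeAut n}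
    {b : Equiv.Perm (Fin 3)} : join a b ∈ wreath H ↔ ∀ i, a i ∈ H := by
  constructor
  · rintro ⟨a', b', ha, h⟩
    obtain ⟨rfl, rfl⟩ := join_injective h
    exact ha
  · exact fun h => ⟨a, b, h, rfl⟩

lemma join_mem_E {n : ℕ} {a : Fin 3 → treeAut (n + 1)} {b : Equiv.Perm (Fin 3)} :
    join a b ∈ E (n + 2) ↔ (∀ i, a i ∈ E (n + 1)) ∧ b.sign * ∏ i, sgnOne n (a i) = 1 := by
  rw [← sgnAt_two_join, ← join_mem_wreath (b := b)]
  rfl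

instance isSolvable_perm_three : Group.IsSolvable (Equiv.Perm (Fin 3)) := by
  have : Group.IsSolvable (Equiv.Perm.sign (α := Fin 3)).ker := by
    refine Group.isSolvable_of_comm ?_
    rintro ⟨a, ha⟩ ⟨b, hb⟩
    rw [Subtype.ext_iff]
    revert a b
    simp only [MonoidHom.mem_ker]
    decide
  refine Group.isSolvable_of_ker_le_range (Subgroup.subtype (Equiv.Perm.sign (α := Fin 3)).ker)
    Equiv.Perm.sign ?_
  rw [Subgroup.range_subtype]

instance subsingleton_treeAut_zero : Subsingleton (treeAut 0) := by
  refine ⟨fun σ τ => Subtype.ext (Equiv.ext fun v => ?_)⟩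
  have : v = root 0 := (level_eq_zero_iff _).1 (Nat.le_zero.1 v.2)
  rw [this, treeAut_root, treeAut_root]

/-- Solvability is what makes the Goursat argument work: a nontrivial quotient of `E n` cannot be
perfect. -/
instance isSolvable_treeAut (n : ℕ) : Group.IsSolvable (treeAut n) := by
  induction n with
  | zero => infer_instance
  | succ n ih =>
    have h1 : Group.IsSolvable (treeAut 1) := by
      refine Group.isSolvable_of_surjective (G := Equiv.Perm (Fin 3))
        (f := { toFun := fun b => join (fun _ => (1 : treeAut 0)) b
                map_one' := join_one
                map_mul' := fun b b' => by rw [join_mul, one_mul] }) fun σ => ?_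
      obtain ⟨a, b, rfl⟩ := exists_eq_join σ
      exact ⟨b, congrArg (join · b) (Subsingleton.elim _ _)⟩
    refine Group.isSolvable_of_ker_le_range (G' := (treeAut n × treeAut n) × treeAut n)
      { toFun := fun p => join ![p.1.1, p.1.2, p.2] 1
        map_one' := by
          rw [← join_one]; congr 1; funext i; fin_cases i <;> rfl
        map_mul' := fun p q => by
          rw [join_mul]; congr 1; funext i; fin_cases i <;> rfl }
      (restrict (Nat.le_add_left 1 n)) fun σ hσ => ?_
    obtain ⟨a, b, rfl⟩ := exists_eq_join σ
    have : restrict (Nat.le_add_left 1 n) (join a b) = join (fun i => restrict n.zero_le (a i)) b :=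
      restrict_join n.zero_le a b
    rw [MonoidHom.mem_ker, this, ← join_one] at hσ
    obtain ⟨-, rfl⟩ := join_injective hσ
    exact ⟨((a 0, a 1), a 2), by
      change join _ _ = _
      congr 1; funext i; fin_cases i <;> rfl⟩

end TernaryTree

lemma Int.units_ne_one_iff {u : ℤˣ} : u ≠ 1 ↔ u = -1 := by
  rcases Int.units_eq_one_or u with rfl | rfl <;> decide

lemma commutator_le_ker {T A : Type*} [Group T] [CommGroup A] (φ : T →* A) (H : Subgroup T) :
    ⁅H, H⁆ ≤ φ.ker :=
  Subgroup.commutator_le.2 fun g _ h _ => by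
    rw [MonoidHom.mem_ker, map_commutatorElement, commutatorElement_eq_one_iff_mul_comm, mul_comm]

lemma commutator_self_le {T : Type*} [Group T] (H : Subgroup T) : ⁅H, H⁆ ≤ H :=
  Subgroup.commutator_le.2 fun _ hg _ hh =>
    H.mul_mem (H.mul_mem (H.mul_mem hg hh) (H.inv_mem hg)) (H.inv_mem hh)

/-- A Goursat-type lemma: a subgroup of `H × H` that surjects onto both factors is everything,
provided that it separates the two copies of the largest abelian quotient `{±1}` of the
solvable group `H`. -/
lemma inl_mem_of_surjective {T : Type*} [Group T] (H : Subgroup T) [Group.IsSolvable H]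
    (χ : T →* ℤˣ) (hχ : ∀ e ∈ H, χ e = 1 → e ∈ ⁅H, H⁆) (M : Subgroup (T × T))
    (hM : ∀ m ∈ M, m.1 ∈ H) (h1 : ∀ e ∈ H, ∃ m ∈ M, m.1 = e) (h2 : ∀ e ∈ H, ∃ m ∈ M, m.2 = e)
    (h2' : ∀ m ∈ M, m.2 ∈ H) (h3 : ∃ m ∈ M, χ m.1 = -1 ∧ χ m.2 = 1) {e : T} (he : e ∈ H) :
    ((e, 1) : T × T) ∈ M := by
  have hcomm : ⁅H, H⁆ ≤ Subgroup.map (MonoidHom.snd T T) ⁅M, M⁆ := by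
    rw [Subgroup.map_commutator]
    have : H ≤ Subgroup.map (MonoidHom.snd T T) M := fun e he => by
      obtain ⟨m, hm, rfl⟩ := h2 e he
      exact ⟨m, hm, rfl⟩
    exact Subgroup.commutator_mono this this
  -- Take `m` with signs `(-1, 1)`. Its second entry lies in `⁅H, H⁆`, so it is also the second
  -- entry of some `k ∈ ⁅M, M⁆`, and `k` has first sign `1`. Then `m * k⁻¹` is `(n, 1)`.
  obtain ⟨n, hnH, hn, hχn⟩ : ∃ n ∈ H, ((n, 1) : T × T) ∈ M ∧ χ n = -1 := by
    obtain ⟨m, hm, hm1, hm2⟩ := h3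
    obtain ⟨k, hk, hk2⟩ := hcomm (hχ m.2 (h2' m hm) hm2)
    have hkM : k ∈ M := commutator_self_le _ hk
    have hk1 : χ k.1 = 1 := commutator_le_ker (χ.comp (MonoidHom.fst T T)) M hk
    have hmk : m * k⁻¹ = (m.1 * k.1⁻¹, 1) :=
      Prod.ext rfl (by change m.2 * k.2⁻¹ = 1; rw [← hk2]; exact mul_inv_cancel _)
    have hmem := M.mul_mem hm (M.inv_mem hkM)
    refine ⟨m.1 * k.1⁻¹, hM _ hmem, hmk ▸ hmem, ?_⟩
    rw [map_mul, map_inv, hm1, hk1, inv_one, mul_one]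
  let N : Subgroup H := (M.comap (MonoidHom.inl T T)).subgroupOf H
  have memN : ∀ x : H, x ∈ N ↔ ((x.1, 1) : T × T) ∈ M := fun x => Iff.rfl
  have hN : N.Normal := ⟨fun x hx g => by
    rw [memN] at hx ⊢
    obtain ⟨m, hm, hmg⟩ := h1 g g.2
    have := M.mul_mem (M.mul_mem hm hx) (M.inv_mem hm)
    convert this using 1
    exact Prod.ext (by simp [hmg]) (by simp)⟩
  -- Multiplying by `n ∈ N` represents every class of `H ⧸ N` by an element with `χ = 1`, hence by
  -- an element of `⁅H, H⁆`. So `H ⧸ N` is perfect as well as solvable, hence trivial.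
  have htop : N = ⊤ := by
    by_contra hne
    have : Nontrivial (H ⧸ N) := QuotientGroup.nontrivial_iff.2 hne
    refine (Group.IsSolvable.commutator_lt_top_of_nontrivial (H ⧸ N)).ne (top_le_iff.1 ?_)
    rintro x -
    obtain ⟨x, rfl⟩ := QuotientGroup.mk_surjective x
    have key : ∀ y : H, χ y = 1 → (y : H ⧸ N) ∈ commutator (H ⧸ N) := fun y hy => by
      have hy' := hχ y y.2 hy
      rw [← Subgroup.map_subtype_commutator] at hy'
      obtain ⟨z, hz, hzy⟩ := hy'
      rw [← (Subtype.ext hzy : z = y)]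
      have := Subgroup.mem_map_of_mem (QuotientGroup.mk' N) hz
      rw [commutator_def, Subgroup.map_commutator] at this
      exact Subgroup.commutator_mono le_top le_top this
    by_cases hx : χ x = 1
    · exact key x hx
    · have h : ((⟨n, hnH⟩ * x : H) : H ⧸ N) = x := by
        rw [QuotientGroup.mk_mul, (QuotientGroup.eq_one_iff (⟨n, hnH⟩ : H)).2 hn, one_mul]
      rw [← h]
      refine key _ ?_
      simp [hχn, Int.units_ne_one_iff.1 hx]
  exact (memN ⟨e, he⟩).1 (htop ▸ Subgroup.mem_top _)

/-! ### The abelianization of `E n` and a generation criterion -/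

namespace TernaryTree

open Vertex

/-- The embedding `(a₁, a₂, a₃) ↦ ((a₁, a₂, a₃), 1)`. -/
def diag (n : ℕ) : (Fin 3 → treeAut n) →* treeAut (n + 1) where
  toFun a := join a 1
  map_one' := join_one
  map_mul' a a' := by rw [join_mul]; rfl

lemma perm_three_cases (b : Equiv.Perm (Fin 3)) (j : Fin 3) (hb : b j = j) :
    b = 1 ∨ b.sign = -1 := by
  revert b j; decide

lemma perm_three_mul (b b' : Equiv.Perm (Fin 3)) (j : Fin 3) (hb : b j = j) (hb' : b' j = j)
    (h : b.sign = -1) (h' : b'.sign = -1) : b * b' = 1 := by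
  revert b b' j; decide

lemma perm_three_commutator (b b' : Equiv.Perm (Fin 3)) (j : Fin 3) (hb : b j = j)
    (hb' : b' j = j) : b * b' * b⁻¹ * b'⁻¹ = 1 := by
  revert b b' j; decide

lemma perm_three_eq_commutator (b : Equiv.Perm (Fin 3)) (h : b.sign = 1) :
    ∃ c d : Equiv.Perm (Fin 3), b = c * d * c⁻¹ * d⁻¹ := by
  revert b; decide

lemma exists_ne_fin_three (i : Fin 3) : ∃ k, i ≠ k := by
  revert i; decide

lemma exists_third (i j : Fin 3) (h : i ≠ j) : ∃ k, k ≠ i ∧ k ≠ j ∧ ∀ l, l = i ∨ l = j ∨ l = k := by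
  revert i j; decide

lemma prod_fin_three_of_ne {A : Type*} [CommMonoid A] {i j k : Fin 3} (hij : i ≠ j) (hki : k ≠ i)
    (hkj : k ≠ j) (ε : Fin 3 → A) : ∏ l, ε l = ε i * ε j * ε k := by
  have : (Finset.univ : Finset (Fin 3)) = {i, j, k} := by revert i j k; decide
  rw [this, Finset.prod_insert (by simp [hij, hki.symm]), Finset.prod_pair hkj.symm, mul_assoc]

/-- The signs that multiply to one and are not all one. -/
lemma sign_pattern (ε : Fin 3 → ℤˣ) (h : ∏ i, ε i = 1) :
    (∀ i, ε i = 1) ∨ ∃ i, ε i = 1 ∧ ∀ k, k ≠ i → ε k = -1 := by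
  rw [Fin.prod_univ_three] at h
  rcases Int.units_eq_one_or (ε 0) with h0 | h0 <;> rcases Int.units_eq_one_or (ε 1) with h1 | h1 <;>
    rcases Int.units_eq_one_or (ε 2) with h2 | h2 <;> simp [h0, h1, h2] at h
  · exact Or.inl fun i => by fin_cases i <;> assumption
  · exact Or.inr ⟨0, h0, fun k hk => by fin_cases k <;> first | assumption | exact absurd rfl hk⟩
  · exact Or.inr ⟨1, h1, fun k hk => by fin_cases k <;> first | assumption | exact absurd rfl hk⟩
  · exact Or.inr ⟨2, h2, fun k hk => by fin_cases k <;> first | assumption | exact absurd rfl hk⟩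

/-- Take one element of `Q` with entry `c` at `i` and `1` at `j`, and another with entry `d` at `i`
and `1` at the third index. At every index other than `i` one of the two is trivial, so their
commutator is concentrated at `i`, where it is `⁅c, d⁆`. -/
lemma join_mulSingle_mem_commutator {n : ℕ} {Q : Subgroup (treeAut (n + 1))}
    {H : Subgroup (treeAut n)}
    (hQ : ∀ i j, i ≠ j → ∀ c ∈ H, ∃ a, join a 1 ∈ Q ∧ a i = c ∧ a j = 1)
    (i : Fin 3) {c : treeAut n} (hc : c ∈ ⁅H, H⁆) : join (Pi.mulSingle i c) 1 ∈ ⁅Q, Q⁆ := by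
  have : ⁅H, H⁆ ≤ ⁅Q, Q⁆.comap ((diag n).comp (MonoidHom.mulSingle (fun _ => treeAut n) i)) := by
    refine Subgroup.commutator_le.2 fun c hc d hd => ?_
    rw [Subgroup.mem_comap]
    obtain ⟨j, hj⟩ : ∃ j, i ≠ j := exists_ne_fin_three i
    obtain ⟨k, hki, hkj, hijk⟩ := exists_third i j hj
    obtain ⟨a, ha, hai, haj⟩ := hQ i j hj c hc
    obtain ⟨a', ha', hai', hak'⟩ := hQ i k hki.symm d hd
    have := Subgroup.commutator_mem_commutator ha ha'
    rw [commutatorElement_def] at this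
    change diag n a * diag n a' * (diag n a)⁻¹ * (diag n a')⁻¹ ∈ _ at this
    rw [← map_inv, ← map_inv, ← map_mul, ← map_mul, ← map_mul] at this
    convert this using 1
    refine congrArg (diag n) (funext fun l => ?_)
    rcases hijk l with rfl | rfl | rfl <;>
      simp_all [commutatorElement_def]
  exact this hc

/-- Two elements of `E (n + 2)` with the same `b` differ by an element with trivial permutation,
whose three signs multiply to `1`. These signs are all `1`, and `h1` applies coordinatewise, or
exactly two of them are `-1`, and dividing by an element from `h2` reduces to the first case. -/
lemma mem_of_join_mem {n : ℕ} {H : Subgroup (treeAut (n + 2))}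
    (hcomm : ∀ e ∈ E (n + 1), sgnOne n e = 1 → e ∈ ⁅E (n + 1), E (n + 1)⁆)
    (h1 : ∀ i, ∀ c ∈ ⁅E (n + 1), E (n + 1)⁆, join (Pi.mulSingle i c) 1 ∈ H)
    (h2 : ∀ i, ∃ a, join a 1 ∈ H ∧ (∀ k, a k ∈ E (n + 1)) ∧ sgnOne n (a i) = 1 ∧
      ∀ k, k ≠ i → sgnOne n (a k) = -1)
    {a a' : Fin 3 → treeAut (n + 1)} {b : Equiv.Perm (Fin 3)} (ha : join a b ∈ E (n + 2))
    (ha' : join a' b ∈ H ⊓ E (n + 2)) : join a b ∈ H := by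
  have mem_of_ker : ∀ a : Fin 3 → treeAut (n + 1), (∀ i, a i ∈ E (n + 1)) →
      (∀ i, sgnOne n (a i) = 1) → join a 1 ∈ H := by
    intro a ha h
    have := fun i => h1 i _ (hcomm _ (ha i) (h i))
    have e : join a 1 = diag n.succ (Pi.mulSingle 0 (a 0) * Pi.mulSingle 1 (a 1) *
        Pi.mulSingle 2 (a 2)) :=
      congrArg (diag n.succ) (funext fun i => by fin_cases i <;> simp)
    rw [e, map_mul, map_mul]
    exact H.mul_mem (H.mul_mem (this 0) (this 1)) (this 2)
  have mem_of_prod : ∀ a : Fin 3 → treeAut (n + 1), (∀ i, a i ∈ E (n + 1)) →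
      (∏ i, sgnOne n (a i) = 1) → join a 1 ∈ H := by
    intro a ha h
    rcases sign_pattern _ h with h | ⟨i, hi, hk⟩
    · exact mem_of_ker a ha h
    · obtain ⟨c, hc, hcE, hci, hck⟩ := h2 i
      have := mem_of_ker (a * c⁻¹) (fun k => mul_mem (ha k) (inv_mem (hcE k))) (fun k => by
        rw [Pi.mul_apply, Pi.inv_apply, map_mul, map_inv]
        by_cases h : k = i
        · rw [h, hi, hci]; rfl
        · rw [hk k h, hck k h]; rfl)
      have := H.mul_mem this hc
      rw [join_mul] at this
      simpa using this
  have hq : join a b * (join a' b)⁻¹ = join (fun i => a (b⁻¹ i) * (a' (b⁻¹ i))⁻¹) 1 := by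
    rw [join_inv, join_mul, mul_inv_cancel]
  have hqE := (E (n + 2)).mul_mem ha ((E (n + 2)).inv_mem ha'.2)
  rw [hq, join_mem_E, map_one, one_mul] at hqE
  have := mem_of_prod _ hqE.1 hqE.2
  rw [← hq] at this
  simpa using H.mul_mem this ha'.1

lemma exists_sgnOne_eq_neg_one (n : ℕ) : ∃ t ∈ E (n + 1), sgnOne n t = -1 := by
  induction n with
  | zero =>
    exact ⟨join 1 (Equiv.swap 0 1), Subgroup.mem_top _, by rw [sgnOne_join]; decide⟩
  | succ n ih =>
    obtain ⟨t, ht, hχ⟩ := ih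
    refine ⟨join (Pi.mulSingle 0 t) (Equiv.swap 0 1), join_mem_E.2 ⟨fun i => ?_, ?_⟩, ?_⟩
    · by_cases h : i = 0
      · subst h; simpa using ht
      · simp [h, one_mem]
    · rw [Fin.prod_univ_three]
      simp [hχ]
    · rw [sgnOne_join]; decide

lemma exists_join_mem_E (n : ℕ) (b : Equiv.Perm (Fin 3)) : ∃ a, join a b ∈ E (n + 2) := by
  obtain ⟨t, ht, hχ⟩ := exists_sgnOne_eq_neg_one n
  rcases Int.units_eq_one_or b.sign with h | h
  · exact ⟨1, join_mem_E.2 ⟨fun i => one_mem _, by simp [h]⟩⟩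
  · refine ⟨Pi.mulSingle 0 t, join_mem_E.2 ⟨fun i => ?_, ?_⟩⟩
    · by_cases hi : i = 0
      · subst hi; simpa using ht
      · simp [hi, one_mem]
    · rw [Fin.prod_univ_three]
      simp [hχ, h]

/-- An even `b` is a commutator in `𝔖₃`, and it lifts to a commutator in `E (n + 2)`. What remains
has trivial permutation and is handled by `mem_of_join_mem` applied to the commutator subgroup
itself. -/
lemma mem_commutator_E (n : ℕ) :
    ∀ e ∈ E (n + 1), sgnOne n e = 1 → e ∈ ⁅E (n + 1), E (n + 1)⁆ := by
  induction n with
  | zero =>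
    intro e _ h
    obtain ⟨a, b, rfl⟩ := exists_eq_join e
    rw [sgnOne_join] at h
    obtain ⟨c, d, rfl⟩ : ∃ c d : Equiv.Perm (Fin 3), b = c * d * c⁻¹ * d⁻¹ :=
      perm_three_eq_commutator b h
    have : join a (c * d * c⁻¹ * d⁻¹) =
        join 1 c * join 1 d * (join 1 c)⁻¹ * (join (1 : Fin 3 → treeAut 0) d)⁻¹ := by
      simp only [join_inv, join_mul]
      exact congrArg (join · _) (Subsingleton.elim _ _)
    rw [this]
    exact Subgroup.commutator_mem_commutator (Subgroup.mem_top _) (Subgroup.mem_top _)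
  | succ n ih =>
    intro e he h
    obtain ⟨t, ht, hχ⟩ := exists_sgnOne_eq_neg_one n
    -- Placing `c` at both `i` and the third index makes the sign product a square.
    have hpair : ∀ i j, i ≠ j → ∀ c ∈ E (n + 1),
        ∃ a, join a 1 ∈ E (n + 2) ∧ a i = c ∧ a j = 1 := by
      intro i j hij c hc
      obtain ⟨k, hki, hkj, hijk⟩ := exists_third i j hij
      refine ⟨fun l => if l = i ∨ l = k then c else 1, join_mem_E.2 ⟨fun l => ?_, ?_⟩, by simp,
        by simp [hij.symm, hkj.symm]⟩
      · split_ifs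
        exacts [hc, one_mem _]
      · rw [prod_fin_three_of_ne hij hki hkj]
        simp [hij.symm, hkj.symm, Int.units_mul_self]
    obtain ⟨a, b, rfl⟩ := exists_eq_join e
    rw [sgnOne_join] at h
    obtain ⟨c, d, rfl⟩ := perm_three_eq_commutator b h
    obtain ⟨u, hu⟩ := exists_join_mem_E n c
    obtain ⟨v, hv⟩ := exists_join_mem_E n d
    have hcd : join u c * join v d * (join u c)⁻¹ * (join v d)⁻¹ ∈ ⁅E (n + 2), E (n + 2)⁆ :=
      Subgroup.commutator_mem_commutator hu hv
    have hcdE := commutator_self_le _ hcd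
    simp only [join_inv, join_mul] at hcd hcdE
    refine mem_of_join_mem ih (fun i c hc => join_mulSingle_mem_commutator hpair i hc)
      (fun i => ?_) he ⟨hcd, hcdE⟩
    -- The commutator with the rotation has entry `a l * (a (l - 1))⁻¹` at `l`: trivial at `i`, and
    -- `t` or `t⁻¹` at the other two indices.
    have hp : join (fun l => if l = i + 1 then 1 else t) 1 ∈ E (n + 2) := by
      refine join_mem_E.2 ⟨fun l => ?_, ?_⟩
      · split_ifs
        exacts [one_mem _, ht]
      · rw [Fin.prod_univ_three]
        fin_cases i <;> simp [hχ]
    have hr : join 1 (finRotate 3) ∈ E (n + 2) := by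
      refine join_mem_E.2 ⟨fun l => one_mem _, ?_⟩
      simp
    have := Subgroup.commutator_mem_commutator hp hr
    rw [commutatorElement_def] at this
    simp only [join_inv, join_mul, one_mul, inv_one, mul_one, mul_inv_cancel] at this
    refine ⟨_, this, fun k => ?_, ?_, fun k hk => ?_⟩
    · simp only [Pi.one_apply]
      split_ifs <;> simp [ht, one_mem]
    · fin_cases i <;> simp [show (-1 : Fin 3) = 2 from rfl]
    · fin_cases i <;> fin_cases k <;> simp [hχ, show (-1 : Fin 3) = 2 from rfl] at hk ⊢

/-- A criterion for a subgroup of `E_{n+2}` to be the whole group. -/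
theorem E_le_of_stabilizer {n : ℕ} {G : Subgroup (treeAut (n + 2))} (hG : G ≤ E (n + 2))
    (j : Fin 3)
    (hstab : ∀ c ∈ E (n + 1), ∃ a b, join a b ∈ G ∧ b j = j ∧ a j = c)
    (hperm : ∀ b, ∃ a, join a b ∈ G)
    (hsgn : ∃ a b, join a b ∈ G ∧ b j = j ∧ sgnOne n (a j) ≠ b.sign) : E (n + 2) ≤ G := by
  have hcoord : ∀ {a b}, join a b ∈ G → ∀ i, a i ∈ E (n + 1) := fun h =>
    (join_mem_E.1 (hG h)).1
  -- Conjugation by an element of `G` above `swap i j` moves the hypothesis from `j` to `i`. The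
  -- target `c` is conjugated beforehand to compensate.
  have hstab' : ∀ i, ∀ c ∈ E (n + 1), ∃ a b, join a b ∈ G ∧ b i = i ∧ a i = c := by
    intro i c hc
    obtain ⟨g, hg⟩ := hperm (Equiv.swap i j)
    obtain ⟨a, b, hab, hb, ha⟩ := hstab (g i * c * (g i)⁻¹)
      (mul_mem (mul_mem (hcoord hg i) hc) (inv_mem (hcoord hg i)))
    have := G.mul_mem (G.mul_mem (G.inv_mem hg) hab) hg
    rw [join_inv, join_mul, join_mul] at this
    refine ⟨_, _, this, ?_, ?_⟩
    · simp [hb]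
    · simp [hb, ha, mul_assoc]
  -- If neither the element of `hsgn` nor a stabilizer element inducing an odd `t` at `j` has
  -- trivial permutation, both permutations are the transposition fixing `j`. The first element is
  -- then even at `j`, and their product has trivial permutation and is odd at `j`.
  have hodd : ∃ a, join a 1 ∈ G ∧ sgnOne n (a j) = -1 := by
    obtain ⟨a, b, hab, hb, hne⟩ := hsgn
    obtain ⟨t, ht, hχ⟩ := exists_sgnOne_eq_neg_one n
    obtain ⟨a', b', hab', hb', ha'⟩ := hstab t ht
    rcases perm_three_cases b j hb with rfl | hs
    · exact ⟨a, hab, Int.units_ne_one_iff.1 hne⟩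
    rcases perm_three_cases b' j hb' with rfl | hs'
    · exact ⟨a', hab', by rw [ha', hχ]⟩
    have := G.mul_mem hab hab'
    rw [join_mul, perm_three_mul b b' j hb hb' hs hs'] at this
    refine ⟨_, this, ?_⟩
    have h1 : sgnOne n (a j) = 1 := by
      by_contra h
      exact hne (by rw [hs, Int.units_ne_one_iff.1 h])
    rw [hb', map_mul, ha', hχ, h1, one_mul]
  have hpattern : ∀ i, ∃ a, join a 1 ∈ G ∧ sgnOne n (a i) = 1 ∧
      ∀ k, k ≠ i → sgnOne n (a k) = -1 := by
    intro i
    obtain ⟨a, ha, haj⟩ := hodd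
    have hprod := (join_mem_E.1 (hG ha)).2
    rw [map_one, one_mul] at hprod
    rcases sign_pattern _ hprod with h | ⟨i', hi', hk⟩
    · rw [h] at haj; exact absurd haj (by decide)
    obtain ⟨g, hg⟩ := hperm (Equiv.swap i i')
    have := G.mul_mem (G.mul_mem hg ha) (G.inv_mem hg)
    rw [join_inv, join_mul, join_mul, mul_one, mul_inv_cancel] at this
    refine ⟨_, this, ?_, fun k hki => ?_⟩
    · simp [hi']
    · have : Equiv.swap i i' k ≠ i' := fun h => hki (by
        rw [Equiv.swap_apply_eq_iff, Equiv.swap_apply_right] at h; exact h)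
      simp [hk _ this]
  -- The stabilizer of `i` in `𝔖₃` is abelian, so commutators of lifts have trivial permutation.
  -- This reaches every even `c`; an odd one is corrected by a sign pattern that is `-1` at `i`.
  have hsurj : ∀ i, ∀ c ∈ E (n + 1), ∃ a, join a 1 ∈ G ∧ a i = c := by
    intro i
    have hone : ∀ c ∈ E (n + 1), sgnOne n c = 1 → ∃ a, join a 1 ∈ G ∧ a i = c := by
      intro c hc h
      have hle : ⁅E (n + 1), E (n + 1)⁆ ≤
          (G.comap (diag (n + 1))).map (Pi.evalMonoidHom (fun _ => treeAut (n + 1)) i) := by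
        refine Subgroup.commutator_le.2 fun c hc d hd => ?_
        obtain ⟨a, b, hab, hb, rfl⟩ := hstab' i c hc
        obtain ⟨a', b', hab', hb', rfl⟩ := hstab' i d hd
        have := G.mul_mem (G.mul_mem (G.mul_mem hab hab') (G.inv_mem hab)) (G.inv_mem hab')
        simp only [join_inv, join_mul] at this
        rw [perm_three_commutator b b' i hb hb'] at this
        refine ⟨_, this, ?_⟩
        have h1 : b⁻¹ i = i := by rw [Equiv.Perm.inv_eq_iff_eq, hb]
        have h2 : b'⁻¹ i = i := by rw [Equiv.Perm.inv_eq_iff_eq, hb']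
        simp only [Pi.evalMonoidHom_apply, h1, h2, hb', commutatorElement_def]
      obtain ⟨a, ha, rfl⟩ := hle (mem_commutator_E n c hc h)
      exact ⟨a, ha, rfl⟩
    intro c hc
    by_cases h : sgnOne n c = 1
    · exact hone c hc h
    · obtain ⟨k, hk⟩ : ∃ k, i ≠ k := exists_ne_fin_three i
      obtain ⟨p, hp, -, hpk⟩ := hpattern k
      obtain ⟨a, ha, hai⟩ := hone (c * (p i)⁻¹) (mul_mem hc (inv_mem (hcoord hp i))) (by
        rw [map_mul, map_inv, hpk i hk, Int.units_ne_one_iff.1 h]; rfl)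
      have := G.mul_mem ha hp
      rw [join_mul, mul_one] at this
      exact ⟨_, this, by simp [hai]⟩
  -- Goursat for the projection to the coordinates `i` and `j`; the sign pattern that is `1` exactly
  -- at `j` separates the two characters.
  have hpair : ∀ i j, i ≠ j → ∀ c ∈ E (n + 1), ∃ a, join a 1 ∈ G ∧ a i = c ∧ a j = 1 := by
    intro i j hij c hc
    let φ : (Fin 3 → treeAut (n + 1)) →* treeAut (n + 1) × treeAut (n + 1) :=
      (Pi.evalMonoidHom _ i).prod (Pi.evalMonoidHom _ j)
    have := inl_mem_of_surjective (E (n + 1)) (sgnOne n) (mem_commutator_E n)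
      ((G.comap (diag (n + 1))).map φ) ?_ ?_ ?_ ?_ ?_ hc
    · obtain ⟨a, ha, h⟩ := this
      exact ⟨a, ha, congrArg Prod.fst h, congrArg Prod.snd h⟩
    · rintro _ ⟨a, ha, rfl⟩
      exact hcoord ha i
    · intro e he
      obtain ⟨a, ha, rfl⟩ := hsurj i e he
      exact ⟨_, ⟨a, ha, rfl⟩, rfl⟩
    · intro e he
      obtain ⟨a, ha, rfl⟩ := hsurj j e he
      exact ⟨_, ⟨a, ha, rfl⟩, rfl⟩
    · rintro _ ⟨a, ha, rfl⟩
      exact hcoord ha j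
    · obtain ⟨a, ha, haj, hak⟩ := hpattern j
      exact ⟨_, ⟨a, ha, rfl⟩, hak i hij, haj⟩
  intro σ hσ
  obtain ⟨a, b, rfl⟩ := exists_eq_join σ
  obtain ⟨a', ha'⟩ := hperm b
  refine mem_of_join_mem (mem_commutator_E n)
    (fun i c hc => commutator_self_le _ (join_mulSingle_mem_commutator hpair i hc))
    (fun i => ?_) hσ ⟨ha', hG ha'⟩
  obtain ⟨p, hp, hpi, hpk⟩ := hpattern i
  exact ⟨p, hp, hcoord hp, hpi, hpk⟩

end TernaryTree

/-! ### Fibres of the cubic and their discriminants -/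

namespace CubicPCF

open TernaryTree TernaryTree.Vertex

section Field

variable {L : Type*} [Field L]

lemma eval_f {R : Type*} [CommRing R] (z : R) : (f R).eval z = -2 * z ^ 3 + 3 * z ^ 2 := by
  simp [f]

/-- `y` enumerates without repetition the fibre of `f` above `x`. -/
structure IsFibre (y : Fin 3 → L) (x : L) : Prop where
  injective : Function.Injective y
  eval : ∀ i, (f L).eval (y i) = x
  exists_eq : ∀ z, (f L).eval z = x → ∃ i, y i = z

/-- The Vandermonde determinant of three elements, a square root of the discriminant. -/
noncomputable def vdm (y : Fin 3 → L) : L := (Matrix.vandermonde y).det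

lemma vdm_eq (y : Fin 3 → L) : vdm y = (y 1 - y 0) * (y 2 - y 0) * (y 2 - y 1) := by
  simp only [vdm, Matrix.det_fin_three, Matrix.vandermonde_apply]
  simp
  ring

lemma vdm_comp (y : Fin 3 → L) (b : Equiv.Perm (Fin 3)) :
    vdm (fun i => y (b i)) = ((b.sign : ℤ) : L) * vdm y := by
  rw [vdm, vdm, ← Matrix.det_permute]
  rfl

lemma map_vdm {L' F : Type*} [Field L'] [FunLike F L L'] [RingHomClass F L L'] (s : F)
    (y : Fin 3 → L) : s (vdm y) = vdm fun i => s (y i) := by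
  simp [vdm_eq]

lemma IsFibre.vdm_ne_zero {y : Fin 3 → L} {x : L} (h : IsFibre y x) : vdm y ≠ 0 :=
  Matrix.det_vandermonde_ne_zero_iff.2 h.injective

variable [CharZero L]

/-- Vieta's relations, obtained by taking divided differences of the three equations. -/
lemma symm_of_eval {y : Fin 3 → L} {x : L} (h : Function.Injective y)
    (he : ∀ i, (f L).eval (y i) = x) :
    2 * (y 0 + y 1 + y 2) = 3 ∧ y 0 * y 1 + y 0 * y 2 + y 1 * y 2 = 0 ∧
      2 * (y 0 * y 1 * y 2) = -x := by
  simp only [eval_f] at he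
  have h0 := he 0
  have h1 := he 1
  have h2 := he 2
  have h01 : y 0 - y 1 ≠ 0 := sub_ne_zero.2 fun e => absurd (h e) (by decide)
  have h02 : y 0 - y 2 ≠ 0 := sub_ne_zero.2 fun e => absurd (h e) (by decide)
  have h12 : y 1 - y 2 ≠ 0 := sub_ne_zero.2 fun e => absurd (h e) (by decide)
  have e01 : 2 * (y 0 ^ 2 + y 0 * y 1 + y 1 ^ 2) = 3 * (y 0 + y 1) := by
    apply mul_left_cancel₀ h01; linear_combination h1 - h0
  have e02 : 2 * (y 0 ^ 2 + y 0 * y 2 + y 2 ^ 2) = 3 * (y 0 + y 2) := by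
    apply mul_left_cancel₀ h02; linear_combination h2 - h0
  have s1 : 2 * (y 0 + y 1 + y 2) = 3 := by
    apply mul_left_cancel₀ h12; linear_combination e01 - e02
  have s2 : y 0 * y 1 + y 0 * y 2 + y 1 * y 2 = 0 := by
    have : (2 : L) ≠ 0 := two_ne_zero
    apply mul_left_cancel₀ this
    linear_combination (y 0 + y 1) * s1 - e01
  refine ⟨s1, s2, ?_⟩
  linear_combination -h0 - y 0 ^ 2 * s1 + 2 * y 0 * s2

lemma isFibre_of_eval {y : Fin 3 → L} {x : L} (h : Function.Injective y)
    (he : ∀ i, (f L).eval (y i) = x) : IsFibre y x := by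
  refine ⟨h, he, fun z hz => ?_⟩
  obtain ⟨s1, s2, s3⟩ := symm_of_eval h he
  rw [eval_f] at hz
  have : 2 * ((z - y 0) * ((z - y 1) * (z - y 2))) = 0 := by
    linear_combination -hz - z ^ 2 * s1 + 2 * z * s2 - s3
  simp only [mul_eq_zero, OfNat.ofNat_ne_zero, false_or, sub_eq_zero] at this
  rcases this with h | h | h
  exacts [⟨0, h.symm⟩, ⟨1, h.symm⟩, ⟨2, h.symm⟩]

lemma IsFibre.symm {y : Fin 3 → L} {x : L} (h : IsFibre y x) :
    2 * (y 0 + y 1 + y 2) = 3 ∧ y 0 * y 1 + y 0 * y 2 + y 1 * y 2 = 0 ∧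
      2 * (y 0 * y 1 * y 2) = -x := symm_of_eval h.injective h.eval

/-- The discriminant of a cubic in its elementary symmetric functions, which are here `3/2`, `0` and
`-x/2`. -/
lemma IsFibre.vdm_sq {y : Fin 3 → L} {x : L} (h : IsFibre y x) :
    4 * vdm y ^ 2 = 27 * (x * (1 - x)) := by
  obtain ⟨s1, s2, s3⟩ := h.symm
  have e1 : y 0 + y 1 + y 2 = 3 / 2 := by linear_combination s1 / 2
  have e3 : y 0 * y 1 * y 2 = -x / 2 := by linear_combination s3 / 2
  have key : vdm y ^ 2 = (y 0 + y 1 + y 2) ^ 2 * (y 0 * y 1 + y 0 * y 2 + y 1 * y 2) ^ 2 -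
      4 * (y 0 * y 1 + y 0 * y 2 + y 1 * y 2) ^ 3 -
      4 * (y 0 + y 1 + y 2) ^ 3 * (y 0 * y 1 * y 2) +
      18 * (y 0 + y 1 + y 2) * (y 0 * y 1 + y 0 * y 2 + y 1 * y 2) * (y 0 * y 1 * y 2) -
      27 * (y 0 * y 1 * y 2) ^ 2 := by
    rw [vdm_eq]; ring
  rw [key, s2, e1, e3]
  ring

/-- Since `0` and `1` are fixed by `f`, evaluating the factored cubic there gives `∏ yᵢ = -x/2` and
`∏ (1 - yᵢ) = (x - 1)/2`. This ties the discriminants of neighbouring levels together. -/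
lemma IsFibre.mul_one_sub {y : Fin 3 → L} {x : L} (h : IsFibre y x) :
    4 * ∏ i, (y i * (1 - y i)) = x * (1 - x) := by
  obtain ⟨s1, s2, s3⟩ := h.symm
  rw [Fin.prod_univ_three]
  have : 2 * ((1 - y 0) * (1 - y 1) * (1 - y 2)) = x - 1 := by
    linear_combination -s1 + 2 * s2 - s3
  linear_combination (x - 1) * s3 + 2 * (y 0 * y 1 * y 2) * this

end Field

/-! ### Oriented labellings and the upper bound for the Galois group -/

section Labelling

variable {L : Type*}

/-- The restriction of a labelling to the subtree above the level-one vertex `i`. -/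
def subLab {n : ℕ} (i : Fin 3) (lab : Vertex (n + 1) → L) : Vertex n → L := fun w => lab (cons i w)

/-- The labels of the level-one vertices. -/
def child {n : ℕ} (lab : Vertex (n + 1) → L) : Fin 3 → L := fun i => lab (cons i (root n))

/-- The labelling of `T_{n+1}` with given label of the root and given labellings of the
subtrees above the level-one vertices. -/
def glue {n : ℕ} (x : L) (labs : Fin 3 → Vertex n → L) : Vertex (n + 1) → L
  | ⟨[], _⟩ => x
  | ⟨i :: w, h⟩ => labs i ⟨w, Nat.le_of_succ_le_succ h⟩

variable [Field L]

/-- Labellings of `T_n` by iterated preimages under `f` of the label of the root, normalized so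
that at each vertex of level at most `n - 2` the canonical square root of the discriminant
of the second iterate has the prescribed sign. -/
def IsOriented : (n : ℕ) → (Vertex n → L) → Prop
  | 0, _ => True
  | 1, lab => IsFibre (child lab) (lab (root 1))
  | n + 2, lab => IsFibre (child lab) (lab (root (n + 2))) ∧
      (∀ i, IsOriented (n + 1) (subLab i lab)) ∧
      32 * (vdm (child lab) * ∏ i, vdm (child (subLab i lab))) =
        729 * (lab (root (n + 2)) * (1 - lab (root (n + 2))))

lemma IsOriented.isFibre {n : ℕ} {lab : Vertex (n + 1) → L} (h : IsOriented (n + 1) lab) :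
    IsFibre (child lab) (lab (root (n + 1))) := by
  cases n with
  | zero => exact h
  | succ n => exact h.1

lemma IsOriented.sub {n : ℕ} {lab : Vertex (n + 1) → L} (h : IsOriented (n + 1) lab) (i : Fin 3) :
    IsOriented n (subLab i lab) := by
  cases n with
  | zero => trivial
  | succ n => exact h.2.1 i

/-- Permuting the level-one labels multiplies their Vandermonde determinant by the sign; this
translates Galois action on square roots into tree signs. -/
lemma map_vdm_child {n : ℕ} {lab lab' : Vertex (n + 1) → L} (s : L ≃+* L) (a : treeAut (n + 1))
    (h : ∀ w, lab' (a.1 w) = s (lab w)) :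
    s (vdm (child lab)) = ((sgnOne n a : ℤ) : L) * vdm (child lab') := by
  obtain ⟨a, b, rfl⟩ := exists_eq_join a
  rw [sgnOne_join, ← vdm_comp, map_vdm]
  congr 1
  funext i
  rw [child, ← h, join_apply_cons, treeAut_root]
  rfl

lemma level_cons {n : ℕ} (i : Fin 3) (w : Vertex n) : (cons i w).level = w.level + 1 := rfl

lemma iterate_lab {n : ℕ} {lab : Vertex n → L} (h : IsOriented n lab) (v : Vertex n) :
    (fun z => (f L).eval z)^[v.level] (lab v) = lab (root n) := by
  induction n with
  | zero =>
    have : v = root 0 := (level_eq_zero_iff v).1 (Nat.le_zero.1 v.2)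
    rw [this]; rfl
  | succ n ih =>
    rcases vertex_cases v with rfl | ⟨i, w, rfl⟩
    · rfl
    · rw [level_cons, Function.iterate_succ_apply']
      have := ih (h.sub i) w
      simp only [subLab] at this
      rw [this]
      exact h.isFibre.eval i

/-- Injectivity holds only level by level: `1/2` is a fixed point of `f`, so labels on different
levels may coincide. Iterating `f` recovers the level-one ancestor, and induction finishes. -/
lemma eq_of_level_eq {n : ℕ} {lab : Vertex n → L} (h : IsOriented n lab) {v w : Vertex n}
    (hvw : v.level = w.level) (hlab : lab v = lab w) : v = w := by
  induction n with
  | zero =>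
    exact ((level_eq_zero_iff v).1 (Nat.le_zero.1 v.2)).trans
      ((level_eq_zero_iff w).1 (Nat.le_zero.1 w.2)).symm
  | succ n ih =>
    rcases vertex_cases v with rfl | ⟨i, v, rfl⟩
    · exact ((level_eq_zero_iff w).1 hvw.symm).symm
    · rcases vertex_cases w with rfl | ⟨j, w, rfl⟩
      · exact (level_eq_zero_iff _).1 hvw
      · have hl : v.level = w.level := Nat.succ_injective hvw
        have hv := iterate_lab (h.sub i) v
        have hw := iterate_lab (h.sub j) w
        simp only [subLab] at hv hw
        rw [hlab, hl, hw] at hv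
        obtain rfl : j = i := h.isFibre.injective hv
        rw [ih (h.sub j) hl hlab]

lemma isTreeLabelling {n : ℕ} {lab : Vertex n → L} (h : IsOriented n lab) :
    IsTreeLabelling n (lab (root n)) lab := by
  refine ⟨fun i hi => ⟨fun v hv => ?_, fun v hv w hw hvw => ?_, fun y hy => ?_⟩, fun v hv => ?_⟩
  · change _ = _
    rw [← iterate_lab h v]
    exact congrArg (fun k => (fun z => (f L).eval z)^[k] (lab v)) (Eq.symm hv)
  · exact eq_of_level_eq h (Eq.trans hv (Eq.symm hw)) hvw
  · induction i generalizing n y with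
    | zero => exact ⟨root n, rfl, Eq.symm hy⟩
    | succ i ih =>
      obtain ⟨n, rfl⟩ : ∃ m, n = m + 1 := ⟨n - 1, by omega⟩
      change (fun z => (f L).eval z)^[i + 1] y = _ at hy
      rw [Function.iterate_succ_apply'] at hy
      obtain ⟨j, hj⟩ := h.isFibre.exists_eq _ hy
      obtain ⟨w, hw, rfl⟩ := ih (h.sub j) (Nat.le_of_succ_le_succ hi) y hj.symm
      exact ⟨cons j w, congrArg Nat.succ hw, rfl⟩
  · induction n with
    | zero => exact absurd ((level_eq_zero_iff v).1 (Nat.le_zero.1 v.2)) hv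
    | succ n ih =>
      rcases vertex_cases v with rfl | ⟨i, w, rfl⟩
      · exact absurd rfl hv
      · rcases parent_cons i w with ⟨rfl, hp⟩ | ⟨hw, hp⟩
        · rw [hp]; exact (h.isFibre.eval i).symm
        · rw [hp]; exact ih (h.sub i) w hw

/-- Extracts the fibre at the root from a split iterate: `p` splits in the splitting field of
`p.comp q`, which maps back to `L`. -/
lemma splits_of_comp {p q : L[X]} (hq : q.natDegree ≠ 0) (h : (p.comp q).Splits) : p.Splits := by
  have h1 := Gal.splits_in_splittingField_of_comp p q hq
  have h' : ((p.comp q).map (algebraMap L L)).Splits := by simpa using h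
  have h2 := h1.map (SplittingField.lift (p.comp q) h').toRingHom
  rw [Polynomial.map_map] at h2
  have h3 : (SplittingField.lift (p.comp q) h').toRingHom.comp
      (algebraMap L (p.comp q).SplittingField) = RingHom.id L :=
    (SplittingField.lift (p.comp q) h').comp_algebraMap
  rwa [h3, Polynomial.map_id] at h2

variable [CharZero L]

/-- Two labellings are allowed because `s` carries the subtree above `i` to the one above `b i`, so
the induction compares different labellings. Applying `s` to the orientation relation of `lab` and
comparing with that of `lab'` leaves the level-two sign as a factor; as the determinants are
nonzero, this sign is `1`. -/
lemma exists_treeAut {n : ℕ} {lab lab' : Vertex n → L} (h : IsOriented n lab)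
    (h' : IsOriented n lab') (s : L ≃+* L) (hs : s (lab (root n)) = lab' (root n)) :
    ∃ a ∈ E n, ∀ w, lab' (a.1 w) = s (lab w) := by
  induction n with
  | zero =>
    refine ⟨1, one_mem _, fun w => ?_⟩
    have : w = root 0 := (level_eq_zero_iff w).1 (Nat.le_zero.1 w.2)
    rw [this, hs]; rfl
  | succ n ih =>
    have hy := h.isFibre
    have hy' := h'.isFibre
    have hb : ∀ i, ∃ j, child lab' j = s (child lab i) := fun i =>
      hy'.exists_eq _ (by
        have := hy.eval i
        rw [eval_f] at this ⊢
        rw [← hs, ← this]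
        simp [map_ofNat s])
    choose b hb using hb
    have hbinj : Function.Injective b := fun i j hij => hy.injective (s.injective (by
      rw [← hb, ← hb, hij]))
    let β : Equiv.Perm (Fin 3) := Equiv.ofBijective b (Finite.injective_iff_bijective.1 hbinj)
    choose a haE ha using fun i => ih (h.sub i) (h'.sub (b i)) (hb i).symm
    have hjoin : ∀ w, lab' ((join a β).1 w) = s (lab w) := by
      intro w
      rcases vertex_cases w with rfl | ⟨i, w, rfl⟩
      · rw [treeAut_root, hs]
      · rw [join_apply_cons]; exact ha i w
    refine ⟨join a β, ?_, hjoin⟩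
    cases n with
    | zero => exact Subgroup.mem_top _
    | succ n =>
      refine join_mem_E.2 ⟨haE, ?_⟩
      have e1 := map_vdm_child s _ hjoin
      have e2 := fun i => map_vdm_child s (a i) (ha i)
      have e := congrArg s h.2.2
      simp only [map_mul, map_prod, map_sub, map_one, map_ofNat, e1, e2, sgnOne_join, hs] at e
      rw [← h'.2.2, Finset.prod_mul_distrib] at e
      have e3 : ∏ i, vdm (child (subLab (b i) lab')) = ∏ i, vdm (child (subLab i lab')) :=
        Equiv.prod_comp β fun i => vdm (child (subLab i lab'))
      rw [e3] at e
      have hne : vdm (child lab') * ∏ i, vdm (child (subLab i lab')) ≠ 0 :=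
        mul_ne_zero hy'.vdm_ne_zero (Finset.prod_ne_zero_iff.2 fun i _ =>
          (h'.sub i).isFibre.vdm_ne_zero)
      have e4 : ((β.sign * ∏ i, sgnOne n (a i) : ℤˣ) : ℤ) = (1 : ℤ) := by
        apply Int.cast_injective (α := L)
        apply mul_right_cancel₀ hne
        push_cast
        linear_combination e / 32
      exact Units.ext e4

lemma natDegree_f : (f L).natDegree = 3 := by
  have : f L = -2 * X ^ 3 + 3 * X ^ 2 := rfl
  rw [this]
  have h2 : (-2 : L[X]) = C (-2) := by rw [map_neg, map_ofNat]
  have h3 : (3 : L[X]) = C 3 := (map_ofNat C 3).symm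
  rw [h2, h3]
  compute_degree!

/-- A repeated root is a zero of `f' = 6z(1-z)`, so `x` would be one of the critical values `0` and
`1`. -/
lemma exists_isFibre {x : L} (hx : x * (1 - x) ≠ 0) (h : (f L - C x).Splits) :
    ∃ y, IsFibre y x := by
  classical
  have hdeg : (f L - C x).natDegree = 3 := by rw [natDegree_sub_C, natDegree_f]
  have h0 : f L - C x ≠ 0 := fun h => by rw [h] at hdeg; simp at hdeg
  have hroot : ∀ z, z ∈ (f L - C x).roots ↔ (f L).eval z = x := fun z => by
    rw [mem_roots h0, IsRoot, eval_sub, eval_C, sub_eq_zero]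
  have hnd : (f L - C x).roots.Nodup := by
    rw [Multiset.nodup_iff_count_le_one]
    intro z
    rw [count_roots]
    by_contra! hz
    rw [one_lt_rootMultiplicity_iff_isRoot h0] at hz
    have h1 : (f L).eval z = x := by
      have := hz.1
      rwa [IsRoot, eval_sub, eval_C, sub_eq_zero] at this
    have h2 : 6 * (z * (1 - z)) = 0 := by
      have := hz.2
      simp [IsRoot, f, derivative_pow] at this
      linear_combination this
    simp only [mul_eq_zero, OfNat.ofNat_ne_zero, false_or, sub_eq_zero] at h2
    rw [eval_f] at h1
    apply hx
    rcases h2 with rfl | rfl <;> rw [← h1] <;> ring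
  have hcard : (f L - C x).roots.toFinset.card = 3 := by
    rw [Multiset.toFinset_card_of_nodup hnd, ← h.natDegree_eq_card_roots, hdeg]
  let e := (Finset.equivFinOfCardEq hcard).symm
  exact ⟨fun i => e i, isFibre_of_eval (Subtype.val_injective.comp e.injective) fun i => by
    rw [← hroot, ← Multiset.mem_toFinset]; exact (e i).2⟩

lemma iterSub_succ {R : Type*} [CommRing R] (n : ℕ) (x : R) :
    iterSub (n + 1) x = (f R - C x).comp ((f R).comp^[n] X) := by
  rw [iterSub, Function.iterate_succ_apply', sub_comp, C_comp]

lemma iterSub_eq_comp {R : Type*} [CommRing R] (n : ℕ) (x : R) :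
    iterSub n x = (X - C x).comp ((f R).comp^[n] X) := by
  rw [iterSub, sub_comp, X_comp, C_comp]

lemma natDegree_iterate_f (n : ℕ) : ((f L).comp^[n] X).natDegree = 3 ^ n := by
  rw [natDegree_iterate_comp, natDegree_f, natDegree_X, mul_one]

lemma natDegree_iterSub (n : ℕ) (x : L) : (iterSub n x).natDegree = 3 ^ n := by
  rw [iterSub, natDegree_sub_C, natDegree_iterate_f]

lemma exists_isOriented (n : ℕ) {x : L} (hx : x * (1 - x) ≠ 0) (h : (iterSub n x).Splits) :
    ∃ lab : Vertex n → L, lab (root n) = x ∧ IsOriented n lab := by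
  induction n generalizing x with
  | zero => exact ⟨fun _ => x, rfl, trivial⟩
  | succ n ih =>
    have h0 : iterSub (n + 1) x ≠ 0 := fun h0 => by
      have := natDegree_iterSub (n + 1) x
      rw [h0, natDegree_zero] at this
      exact absurd this.symm (pow_ne_zero _ three_ne_zero)
    obtain ⟨y, hy⟩ := exists_isFibre hx (splits_of_comp
      (by rw [natDegree_iterate_f n]; positivity) (iterSub_succ n x ▸ h))
    have hylab : ∀ i, ∃ lab : Vertex n → L, lab (root n) = y i ∧ IsOriented n lab := by
      intro i
      refine ih (fun h0 => hx ?_) ?_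
      · rw [← hy.mul_one_sub, Finset.prod_eq_zero (Finset.mem_univ i) h0, mul_zero]
      · refine h.of_dvd h0 ?_
        rw [iterSub_succ, iterSub_eq_comp]
        have : X - C (y i) ∣ f L - C x := by
          rw [dvd_iff_isRoot, IsRoot, eval_sub, eval_C, hy.eval, sub_self]
        obtain ⟨g, hg⟩ := this
        rw [hg, mul_comp]
        exact dvd_mul_right _ _
    choose labs hroot hlabs using hylab
    cases n with
    | zero =>
      refine ⟨glue x labs, rfl, ?_⟩
      have : child (glue x labs) = y := funext hroot
      change IsFibre _ _
      rwa [this]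
    | succ n =>
      -- Four discriminants contribute `(27/4)^4`, and `mul_one_sub` contributes `1/4`; the product
      -- is `(729/32)^2`.
      have hsq : (32 * (vdm y * ∏ i, vdm (child (labs i)))) ^ 2 = (729 * (x * (1 - x))) ^ 2 := by
        have h1 := hy.vdm_sq
        have h2 := hy.mul_one_sub
        have h3 : ∏ i, (4 * vdm (child (labs i)) ^ 2) = ∏ i, (27 * (y i * (1 - y i))) :=
          Finset.prod_congr rfl fun i _ => by rw [(hlabs i).isFibre.vdm_sq, hroot]
        rw [Finset.prod_mul_distrib, Finset.prod_mul_distrib, Finset.prod_pow, Finset.prod_const,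
          Finset.prod_const] at h3
        simp only [Finset.card_univ, Fintype.card_fin] at h3
        linear_combination 4 * 64 * (∏ i, vdm (child (labs i))) ^ 2 * h1 +
          4 * 27 * (x * (1 - x)) * h3 + 27 ^ 4 * (x * (1 - x)) * h2
      -- If the sign is wrong, exchanging two level-one vertices with their subtrees negates `vdm y`
      -- and leaves the product over the subtrees and their orientations unchanged.
      have hperm : ∃ b : Equiv.Perm (Fin 3),
          32 * (vdm (fun i => y (b i)) * ∏ i, vdm (child (labs (b i)))) = 729 * (x * (1 - x)) := by
        have hb : ∀ b : Equiv.Perm (Fin 3), ∏ i, vdm (child (labs (b i))) =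
            ∏ i, vdm (child (labs i)) := fun b => Equiv.prod_comp b fun i => vdm (child (labs i))
        simp only [hb, vdm_comp]
        rcases sq_eq_sq_iff_eq_or_eq_neg.1 hsq with h | h
        · exact ⟨1, by simpa using h⟩
        · refine ⟨Equiv.swap 0 1, ?_⟩
          rw [Equiv.Perm.sign_swap (by decide)]
          push_cast
          linear_combination -h
      obtain ⟨b, hb⟩ := hperm
      have hch : child (glue x fun i => labs (b i)) = fun i => y (b i) :=
        funext fun i => hroot (b i)
      refine ⟨glue x fun i => labs (b i), rfl, ?_, fun i => hlabs (b i), ?_⟩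
      · rw [hch]
        exact isFibre_of_eval (hy.injective.comp b.injective) fun i => hy.eval (b i)
      · rw [hch]
        exact hb

end Labelling
end CubicPCF

open IsDedekindDomain WithZero

/-! ### Nonsquares at primes above two -/

section Valuation

variable {K : Type*} [Field K] (v : Valuation K ℤᵐ⁰)

lemma WithZero.exp_pow (k : ℤ) (n : ℕ) : (exp k : ℤᵐ⁰) ^ n = exp (n * k) := by
  rw [← exp_nsmul, nsmul_eq_mul]

lemma WithZero.exp_mul (k l : ℤ) : (exp k : ℤᵐ⁰) * exp l = exp (k + l) := (exp_add k l).symm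

lemma WithZero.exp_lt_one {k : ℤ} : (exp k : ℤᵐ⁰) < 1 ↔ k < 0 := by
  rw [← exp_zero, exp_lt_exp]

lemma WithZero.eq_or_exists_eq_exp (x : ℤᵐ⁰) : x = 0 ∨ ∃ k, x = exp k := by
  rcases eq_or_ne x 0 with h | h
  · exact Or.inl h
  · exact Or.inr ⟨log x, (exp_log h).symm⟩

lemma WithZero.le_exp_neg_one {x : ℤᵐ⁰} (h : x < 1) : x ≤ exp (-1) := by
  rcases x.eq_or_exists_eq_exp with rfl | ⟨k, rfl⟩
  · exact zero_le
  · rw [exp_lt_one] at h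
    rw [exp_le_exp]; omega

variable {v}

lemma Valuation.not_isSquare_of_odd {d : K} {k : ℤ} (hd : v d = exp k) (hk : Odd k) :
    ¬ IsSquare d := by
  rintro ⟨s, rfl⟩
  rcases (v s).eq_or_exists_eq_exp with h | ⟨m, hm⟩
  · rw [map_mul, h, zero_mul] at hd
    exact exp_ne_zero hd.symm
  · rw [map_mul, hm, exp_mul, exp_inj] at hd
    exact Int.not_even_iff_odd.2 hk ⟨m, hd.symm⟩

/-- If `d = s²`, the factors `s - 1` and `s + 1` of `d - 1` agree modulo `2`. As one has positive
order so does the other, and `d - 1` has order at least `2`. -/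
lemma Valuation.not_isSquare_of_sub_one {d : K} (h2 : v 2 < 1) (hd : v (d - 1) = exp (-1)) :
    ¬ IsSquare d := by
  rintro ⟨s, rfl⟩
  have hmul : v (s - 1) * v (s + 1) = exp (-1) := by rw [← map_mul, ← hd]; congr 1; ring
  have hlt : (exp (-1) : ℤᵐ⁰) < 1 := by rw [exp_lt_one]; decide
  have h1 : v (s - 1) < 1 ∨ v (s + 1) < 1 := by
    by_contra! h
    exact absurd (hmul ▸ hlt) (not_lt.2 (one_le_mul h.1 h.2))
  have h12 : v (s - 1) < 1 ∧ v (s + 1) < 1 := by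
    rcases h1 with h | h
    · exact ⟨h, by have := v.map_add_lt h h2; rwa [show s - 1 + 2 = s + 1 by ring] at this⟩
    · exact ⟨by have := v.map_sub_lt h h2; rwa [show s + 1 - 2 = s - 1 by ring] at this, h⟩
  have := mul_le_mul' (le_exp_neg_one h12.1) (le_exp_neg_one h12.2)
  rw [hmul, exp_mul, exp_le_exp] at this
  norm_num at this

lemma Valuation.map_three (h2 : v 2 < 1) : v 3 = 1 := by
  have := v.map_one_add_of_lt h2
  rwa [show (1 : K) + 2 = 3 by norm_num] at this

lemma Valuation.map_two_of_three (h3 : v 3 < 1) : v 2 = 1 := by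
  have := v.map_one_sub_of_lt h3
  rwa [show (1 : K) - 3 = -2 by norm_num, v.map_neg] at this

/-- For `k = 1` the order is odd. For `k = -1`, dividing by `x²` gives `1 + (3x⁻¹ - 4)`, where
`3x⁻¹` has order `1` and `4` order at least `2`. -/
lemma Valuation.not_isSquare_discr {x : K} {k : ℤ} (h2 : v 2 < 1) (hk : k = 1 ∨ k = -1)
    (hx : v x = exp (-k)) : ¬ IsSquare (3 * (x * (1 - x))) := by
  rcases hk with rfl | rfl
  · have h1 : v (1 - x) = 1 := v.map_one_sub_of_lt (by rw [hx, exp_lt_one]; decide)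
    exact not_isSquare_of_odd (v := v) (k := -1) (by simp [map_three h2, h1, hx]) (by decide)
  · have hx0 : x ≠ 0 := fun h => exp_ne_zero (hx.symm.trans (by rw [h, map_zero]))
    intro hsq
    have h3 : v (3 * x⁻¹) = exp (-1) := by rw [map_mul, map_three h2, map_inv₀, hx, one_mul]; rfl
    have h4 : v 4 < exp (-1) := by
      have := mul_le_mul' (le_exp_neg_one h2) (le_exp_neg_one h2)
      rw [← map_mul, exp_mul] at this
      rw [show (4 : K) = 2 * 2 by norm_num]
      exact this.trans_lt (by rw [exp_lt_exp]; decide)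
    refine not_isSquare_of_sub_one (v := v) (d := 3 * (x * (1 - x)) * (x⁻¹ * x⁻¹)) h2 ?_
      (hsq.mul ⟨_, rfl⟩)
    have : 3 * (x * (1 - x)) * (x⁻¹ * x⁻¹) - 1 = 3 * x⁻¹ - 4 := by field_simp; ring
    rw [this, v.map_sub_eq_of_lt_left (by rw [h3]; exact h4), h3]

/-- For `k = 1` the order is `3`. For `k = -1`, dividing by `(xy)²` gives `(x⁻¹ - 1)(y⁻¹ - 1)`,
which differs from `1` by an element of order `1`, the order of `y⁻¹`. -/
lemma Valuation.not_isSquare_discr_mul {x y : K} {k : ℤ} (h2 : v 2 < 1) (hk : k = 1 ∨ k = -1)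
    (hx : v x = exp (-(2 * k))) (hy : v y = exp (-k)) :
    ¬ IsSquare (x * (1 - x) * (y * (1 - y))) := by
  rcases hk with rfl | rfl
  · have h1 : v (1 - x) = 1 := v.map_one_sub_of_lt (by rw [hx, exp_lt_one]; decide)
    have h1' : v (1 - y) = 1 := v.map_one_sub_of_lt (by rw [hy, exp_lt_one]; decide)
    refine not_isSquare_of_odd (v := v) (k := -3) ?_ (by decide)
    simp only [map_mul, h1, h1', hx, hy, mul_one, exp_mul]
    rfl
  · have hx0 : x ≠ 0 := fun h => exp_ne_zero (hx.symm.trans (by rw [h, map_zero]))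
    have hy0 : y ≠ 0 := fun h => exp_ne_zero (hy.symm.trans (by rw [h, map_zero]))
    intro hsq
    have h1 : v y⁻¹ = exp (-1) := by rw [map_inv₀, hy]; rfl
    have h3 : v (x⁻¹ * (y⁻¹ - 1)) < v y⁻¹ := by
      have : v (y⁻¹ - 1) = 1 := by
        rw [v.map_sub_swap, v.map_one_sub_of_lt (by rw [h1, exp_lt_one]; decide)]
      rw [map_mul, this, mul_one, map_inv₀, hx, h1, ← exp_neg, exp_lt_exp]
      decide
    refine not_isSquare_of_sub_one (v := v)
      (d := x * (1 - x) * (y * (1 - y)) * ((x⁻¹ * y⁻¹) * (x⁻¹ * y⁻¹))) h2 ?_ (hsq.mul ⟨_, rfl⟩)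
    have : x * (1 - x) * (y * (1 - y)) * ((x⁻¹ * y⁻¹) * (x⁻¹ * y⁻¹)) - 1 =
        x⁻¹ * (y⁻¹ - 1) - y⁻¹ := by field_simp; ring
    rw [this, v.map_sub_eq_of_lt_right h3, h1]

end Valuation

/-! ### Primes in extensions and preservation of the hypotheses -/

namespace IsDedekindDomain.HeightOneSpectrum

variable {K L : Type*} [Field K] [Field L] [Algebra K L]

lemma exists_liesOver (p : HeightOneSpectrum (𝓞 K)) :
    ∃ P : HeightOneSpectrum (𝓞 L), P.asIdeal.LiesOver p.asIdeal := by
  obtain ⟨⟨P, hP, hPp⟩⟩ := p.asIdeal.nonempty_primesOver (S := 𝓞 L)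
  exact ⟨⟨P, hP, Ideal.ne_bot_of_liesOver_of_ne_bot p.ne_bot P⟩, hPp⟩

lemma liesOver_under (P : HeightOneSpectrum (𝓞 L)) :
    P.asIdeal.LiesOver (P.under (𝓞 K)).asIdeal := ⟨rfl⟩

variable [NumberField K] [NumberField L]

set_option linter.deprecated false in
-- The exponent is the ramification index. Its bound by the degree later forces the exact
-- ramification in extensions of degree at most three.
lemma exists_valuation_algebraMap (p : HeightOneSpectrum (𝓞 K)) (P : HeightOneSpectrum (𝓞 L))
    [P.asIdeal.LiesOver p.asIdeal] : ∃ e : ℕ, 0 < e ∧ e ≤ Module.finrank K L ∧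
      ∀ x : K, P.valuation L (algebraMap K L x) = p.valuation K x ^ e := by
  refine ⟨p.asIdeal.ramificationIdx' P.asIdeal, Nat.pos_of_ne_zero
    (Ideal.IsDedekindDomain.ramificationIdx'_ne_zero_of_liesOver P.asIdeal p.ne_bot), ?_,
    fun x => (valuation_liesOver L p P x).symm⟩
  have : NoZeroSMulDivisors (𝓞 K) (𝓞 L) := ⟨fun h => smul_eq_zero.1 h⟩
  exact Ideal.ramificationIdx_le_finrank (𝓞 L) K L P.asIdeal

lemma valuation_lt_one_of_mem {p : HeightOneSpectrum (𝓞 K)} (n : ℕ) [n.AtLeastTwo]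
    (h : (ofNat(n) : 𝓞 K) ∈ p.asIdeal) : p.valuation K (ofNat(n) : K) < 1 := by
  have e : algebraMap (𝓞 K) K (ofNat(n)) = ofNat(n) := map_ofNat _ n
  rw [← e]
  exact (p.valuation_lt_one_iff_mem (K := K) _).2 h

lemma mem_of_valuation_lt_one {p : HeightOneSpectrum (𝓞 K)} (n : ℕ) [n.AtLeastTwo]
    (h : p.valuation K (ofNat(n) : K) < 1) : (ofNat(n) : 𝓞 K) ∈ p.asIdeal := by
  have e : algebraMap (𝓞 K) K (ofNat(n)) = ofNat(n) := map_ofNat _ n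
  rw [← e] at h
  exact (p.valuation_lt_one_iff_mem (K := K) _).1 h

end IsDedekindDomain.HeightOneSpectrum

namespace CubicPCF

open IsDedekindDomain.HeightOneSpectrum

lemma map_eval_f {R S : Type*} [CommRing R] [CommRing S] (s : R →+* S) (z : R) :
    s ((f R).eval z) = (f S).eval (s z) := by
  rw [eval_f, eval_f]
  simp [map_ofNat s]

/-- The symmetry `f(1 - z) = 1 - f(z)` reduces the hypothesis on `1 - x` to the one on `x`. -/
lemma IsFibre.one_sub {L : Type*} [Field L] [CharZero L] {y : Fin 3 → L} {x : L}
    (h : IsFibre y x) : IsFibre (fun i => 1 - y i) (1 - x) :=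
  isFibre_of_eval (fun i j hij => h.injective (sub_right_injective hij)) fun i => by
    have := h.eval i
    rw [eval_f] at this ⊢
    rw [← this]
    ring

section Valuation

variable {L : Type*} [Field L] (v : Valuation L ℤᵐ⁰)

/-- Write `f(y) = y²(3 - 2y)`; the second factor is a unit. Bounding `2y` rather than `y` admits
preimages with a pole. -/
lemma valuation_sq_of_eval {x y : L} (hy : (f L).eval y = x) (h2 : v 2 < 1)
    (h2y : v (2 * y) < 1) : v y ^ 2 = v x := by
  have h3 : v (3 - 2 * y) = 1 := by
    rw [v.map_sub_eq_of_lt_left (by rw [Valuation.map_three h2]; exact h2y),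
      Valuation.map_three h2]
  rw [← hy, eval_f, show -2 * y ^ 3 + 3 * y ^ 2 = y ^ 2 * (3 - 2 * y) by ring, map_mul, h3,
    mul_one, map_pow]

/-- If `y` were not in the maximal ideal, `-2y³` would dominate and `x` would not be there either.
Hence `3y²` is strictly smaller than `x`, and `-2y³` has the valuation of `x`. -/
lemma valuation_cube_of_eval {x y : L} (hy : (f L).eval y = x) (h3 : v 3 < 1)
    (hx : v x < 1) (hx0 : x ≠ 0) (h3x : v 3 ≤ v x) : v y ^ 3 = v x := by
  have h2 : v (-2 * y ^ 3) = v y ^ 3 := by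
    rw [map_mul, v.map_neg, Valuation.map_two_of_three h3, one_mul, map_pow]
  rw [eval_f] at hy
  have hy1 : v y < 1 := by
    by_contra! h
    have hlt : v (3 * y ^ 2) < v (-2 * y ^ 3) := by
      rw [h2, map_mul, map_pow]
      calc v 3 * v y ^ 2 < 1 * v y ^ 2 := by
            gcongr
            exact pow_pos (zero_lt_one.trans_le h) 2
        _ ≤ v y ^ 3 := by rw [one_mul]; exact pow_le_pow_right₀ h (by norm_num)
    have := v.map_add_eq_of_lt_left hlt
    rw [hy, h2] at this
    rw [this] at hx
    exact absurd hx (not_lt.2 (one_le_pow₀ h))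
  have hlt : v (3 * y ^ 2) < v x := by
    rw [map_mul, map_pow]
    calc v 3 * v y ^ 2 ≤ v x * v y ^ 2 := by gcongr
      _ < v x * 1 := by
        gcongr
        · exact zero_lt_iff.2 (v.ne_zero_iff.2 hx0)
        · exact pow_lt_one₀ zero_le hy1 two_ne_zero
      _ = v x := mul_one _
  have := v.map_sub_eq_of_lt_left hlt
  rw [← this, ← h2]
  congr 1
  linear_combination hy

end Valuation

section NumberField

variable {K : Type u} [Field K] [NumberField K]

/-- The arithmetic hypotheses on `x`. -/
def IsAdmissible (x : K) : Prop :=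
  (∃ p : HeightOneSpectrum (𝓞 K), (2 : 𝓞 K) ∈ p.asIdeal ∧ ∃ k : ℤ, (k = 1 ∨ k = -1) ∧
    (HasOrd p x k ∨ HasOrd p (1 - x) k)) ∧
  ∃ q : HeightOneSpectrum (𝓞 K), (3 : 𝓞 K) ∈ q.asIdeal ∧ HasOrd q x 1

lemma IsAdmissible.not_isSquare_discr {x : K} (h : IsAdmissible x) :
    ¬ IsSquare (3 * (x * (1 - x))) := by
  obtain ⟨⟨p, hp, k, hk, hx | hx⟩, -⟩ := h
  · exact Valuation.not_isSquare_discr (valuation_lt_one_of_mem 2 hp) hk hx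
  · have := Valuation.not_isSquare_discr (valuation_lt_one_of_mem 2 hp) hk hx
    rwa [sub_sub_cancel, mul_comm (1 - x)] at this

variable {Ω : Type u} [Field Ω] [NumberField Ω] [Algebra K Ω]

/-- Among the preimages of `x` under `f`, one has half the valuation of `x` at some
prime above two. -/
lemma exists_hasOrd_of_isFibre {x : K} {y : Fin 3 → Ω} (hy : IsFibre y (algebraMap K Ω x))
    (p : HeightOneSpectrum (𝓞 K)) (hp : (2 : 𝓞 K) ∈ p.asIdeal) {k : ℤ} (hk : k = 1 ∨ k = -1)
    (hx : HasOrd p x k) : ∃ j, ∀ (F : IntermediateField K Ω) (z : F), Module.finrank K F ≤ 3 →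
      (z : Ω) = y j → ∃ P : HeightOneSpectrum (𝓞 F), (2 : 𝓞 F) ∈ P.asIdeal ∧
        HasOrd P z k ∧ HasOrd P (algebraMap K F x) (2 * k) := by
  obtain ⟨P, hP⟩ := p.exists_liesOver (L := Ω)
  obtain ⟨e, he, -, hPe⟩ := p.exists_valuation_algebraMap P
  have h2 := valuation_lt_one_of_mem 2 hp
  have h4 : p.valuation K (4 * x) < 1 := by
    have := mul_le_mul' (le_exp_neg_one h2) (le_exp_neg_one h2)
    rw [← map_mul, exp_mul] at this
    rw [show (4 : K) = 2 * 2 by norm_num, map_mul]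
    refine (mul_le_mul' this hx.le).trans_lt ?_
    rw [exp_mul, exp_lt_one]
    omega
  -- The product of the `2 * y i` is `-4x`, of positive order because `x` has order at least `-1`.
  -- So some `2 * y j` has positive order at `P`.
  have hprod : ∏ i, P.valuation Ω (2 * y i) < 1 := by
    rw [← map_prod, Fin.prod_univ_three]
    have : 2 * y 0 * (2 * y 1) * (2 * y 2) = -algebraMap K Ω (4 * x) := by
      rw [map_mul, map_ofNat]
      linear_combination 4 * hy.symm.2.2
    rw [this, Valuation.map_neg, hPe]
    exact pow_lt_one₀ zero_le h4 he.ne'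
  obtain ⟨j, hj⟩ : ∃ j, P.valuation Ω (2 * y j) < 1 := by
    by_contra! h
    exact absurd hprod (not_lt.2 (Finset.one_le_prod' fun i _ => h i))
  refine ⟨j, fun F z hF hz => ?_⟩
  have := liesOver_under (K := F) P
  obtain ⟨e', he', -, hPe'⟩ := (P.under (𝓞 F)).exists_valuation_algebraMap P
  have hlt : ∀ u : F, P.valuation Ω u < 1 → (P.under (𝓞 F)).valuation F u < 1 := fun u hu => by
    by_contra! h
    have := hPe' u
    exact absurd hu (not_lt.2 (this ▸ one_le_pow₀ h))
  have h2P : P.valuation Ω 2 < 1 := by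
    have := hPe 2
    rw [map_ofNat] at this
    rw [this]
    exact pow_lt_one₀ zero_le h2 he.ne'
  have h2F : (P.under (𝓞 F)).valuation F 2 < 1 := hlt 2 h2P
  have hFp : (P.under (𝓞 F)).asIdeal.LiesOver p.asIdeal :=
    Ideal.LiesOver.tower_bot P.asIdeal _ _
  obtain ⟨e'', he'', hle, hPe''⟩ := p.exists_valuation_algebraMap (P.under (𝓞 F))
  have hzx : (f F).eval z = algebraMap K F x := by
    apply (algebraMap F Ω).injective
    rw [map_eval_f, ← IsScalarTower.algebraMap_apply K F Ω, ← hy.eval j, ← hz]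
    rfl
  have hsq := valuation_sq_of_eval _ hzx h2F (hlt _ (by
    have : ((2 * z : F) : Ω) = 2 * y j := by rw [← hz]; rfl
    rw [this]; exact hj))
  have hordx := hPe'' x
  rw [hx, exp_pow] at hordx
  rw [hordx] at hsq
  have hz0 : (P.under (𝓞 F)).valuation F z ≠ 0 := fun h0 => by
    rw [h0] at hsq
    exact exp_ne_zero (hsq.symm.trans (by simp))
  obtain ⟨m, hm⟩ := ((P.under (𝓞 F)).valuation F z).eq_or_exists_eq_exp.resolve_left hz0
  rw [hm, exp_pow, exp_inj] at hsq
  -- Twice the order of `z` is `e'' * k`, so `e''` is even; it is also positive and at most `3`.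
  have he2 : e'' = 2 := by
    have := hle.trans hF
    rcases hk with rfl | rfl <;> push_cast at hsq <;> omega
  subst he2
  refine ⟨P.under (𝓞 F), mem_of_valuation_lt_one 2 h2F, ?_, ?_⟩
  · rw [HasOrd, hm, exp_inj]
    push_cast at hsq; omega
  · rw [HasOrd, hordx, exp_inj]
    push_cast; ring

/-- At a prime above three, the preimages of an element of valuation one under `f` are again
of valuation one for the prime above. -/
lemma exists_hasOrd_one {x : K} (q : HeightOneSpectrum (𝓞 K)) (hq : (3 : 𝓞 K) ∈ q.asIdeal)
    (hx : HasOrd q x 1) {F : Type u} [Field F] [NumberField F] [Algebra K F] {z : F}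
    (hF : Module.finrank K F ≤ 3) (hz : (f F).eval z = algebraMap K F x) :
    ∃ Q : HeightOneSpectrum (𝓞 F), (3 : 𝓞 F) ∈ Q.asIdeal ∧ HasOrd Q z 1 := by
  obtain ⟨Q, hQ⟩ := q.exists_liesOver (L := F)
  obtain ⟨e, he, hle, hQe⟩ := q.exists_valuation_algebraMap Q
  have h3 := valuation_lt_one_of_mem 3 hq
  have h3F : Q.valuation F 3 = q.valuation K 3 ^ e := by
    rw [← hQe, map_ofNat (algebraMap K F)]
  have hcube := valuation_cube_of_eval (Q.valuation F) hz
    (by rw [h3F]; exact pow_lt_one₀ zero_le h3 he.ne')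
    (by rw [hQe, hx]; exact pow_lt_one₀ zero_le (by rw [exp_lt_one]; decide) he.ne')
    (fun h0 => by
      have := hQe x
      rw [h0, map_zero, hx, exp_pow] at this
      exact exp_ne_zero this.symm)
    (by rw [h3F, hQe, hx]; exact pow_le_pow_left₀ zero_le (le_exp_neg_one h3) e)
  rw [hQe, hx, exp_pow] at hcube
  have hz0 : Q.valuation F z ≠ 0 := fun h0 => by
    rw [h0] at hcube
    exact exp_ne_zero (hcube.symm.trans (by simp))
  obtain ⟨m, hm⟩ := (Q.valuation F z).eq_or_exists_eq_exp.resolve_left hz0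
  rw [hm, exp_pow, exp_inj] at hcube
  refine ⟨Q, mem_of_valuation_lt_one 3 ?_, ?_⟩
  · rw [h3F]; exact pow_lt_one₀ zero_le h3 he.ne'
  -- Three times the order of `z` is `e`, and `0 < e ≤ 3`, so `e = 3` and `z` has order `1`.
  · have := hle.trans hF
    rw [HasOrd, hm, exp_inj]
    push_cast at hcube
    omega

/-- The arithmetic hypotheses pass to the extension generated by a suitable preimage. -/
lemma IsAdmissible.exists_preimage {x : K} (h : IsAdmissible x) {y : Fin 3 → Ω}
    (hy : IsFibre y (algebraMap K Ω x)) :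
    ∃ j, ∀ (F : IntermediateField K Ω) (z : F), Module.finrank K F ≤ 3 → (z : Ω) = y j →
      IsAdmissible z ∧
        ¬ IsSquare (algebraMap K F x * (1 - algebraMap K F x) * (z * (1 - z))) := by
  obtain ⟨⟨p, hp, k, hk, hx⟩, q, hq, hxq⟩ := h
  have hthree : ∀ (j : Fin 3) (F : IntermediateField K Ω) (z : F), Module.finrank K F ≤ 3 →
      (z : Ω) = y j → ∃ Q : HeightOneSpectrum (𝓞 F), (3 : 𝓞 F) ∈ Q.asIdeal ∧ HasOrd Q z 1 := by
    intro j F z hF hz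
    refine exists_hasOrd_one q hq hxq hF ?_
    apply (algebraMap F Ω).injective
    rw [map_eval_f, ← IsScalarTower.algebraMap_apply K F Ω, ← hy.eval j, ← hz]
    rfl
  rcases hx with hx | hx
  · obtain ⟨j, hj⟩ := exists_hasOrd_of_isFibre hy p hp hk hx
    refine ⟨j, fun F z hF hz => ?_⟩
    obtain ⟨P, hP, hPz, hPx⟩ := hj F z hF hz
    exact ⟨⟨⟨P, hP, k, hk, Or.inl hPz⟩, hthree j F z hF hz⟩,
      Valuation.not_isSquare_discr_mul (valuation_lt_one_of_mem 2 hP) hk hPx hPz⟩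
  · have hy' := hy.one_sub
    rw [← map_one (algebraMap K Ω), ← map_sub] at hy'
    obtain ⟨j, hj⟩ := exists_hasOrd_of_isFibre hy' p hp hk hx
    refine ⟨j, fun F z hF hz => ?_⟩
    obtain ⟨P, hP, hPz, hPx⟩ := hj F (1 - z) hF (by rw [← hz, map_one]; rfl)
    refine ⟨⟨⟨P, hP, k, hk, Or.inr hPz⟩, hthree j F z hF hz⟩, ?_⟩
    have := Valuation.not_isSquare_discr_mul (valuation_lt_one_of_mem 2 hP) hk hPx hPz
    rw [map_sub, map_one, sub_sub_cancel, sub_sub_cancel] at this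
    rwa [mul_comm (algebraMap K F x), mul_comm z]

end NumberField

end CubicPCF

/-! ### The Eisenstein property -/

namespace CubicPCF

open TernaryTree TernaryTree.Vertex

section Eisenstein

lemma map_f {R S : Type*} [CommRing R] [CommRing S] (s : R →+* S) : (f R).map s = f S := by
  simp [f]

lemma map_iterate_f {R S : Type*} [CommRing R] [CommRing S] (s : R →+* S) (n : ℕ) :
    ((f R).comp^[n] X).map s = (f S).comp^[n] X := by
  induction n with
  | zero => simp
  | succ n ih => rw [Function.iterate_succ_apply', Function.iterate_succ_apply', map_comp, ih, map_f]

lemma map_iterSub {R S : Type*} [CommRing R] [CommRing S] (s : R →+* S) (n : ℕ) (x : R) :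
    (iterSub n x).map s = iterSub n (s x) := by
  rw [iterSub, iterSub, Polynomial.map_sub, map_iterate_f, map_C]

lemma iterate_f_of_three {R : Type*} [CommRing R] (h : (3 : R) = 0) (n : ℕ) :
    (f R).comp^[n] X = X ^ 3 ^ n := by
  have h3 : (3 : R[X]) = 0 := by rw [← map_ofNat C 3, h, map_zero]
  have hf : f R = X ^ 3 := by
    rw [f]; linear_combination (X ^ 2 - X ^ 3) * h3
  induction n with
  | zero => simp
  | succ n ih => rw [Function.iterate_succ_apply', ih, hf, X_pow_comp, ← pow_mul, pow_succ]

lemma eval_zero_iterate_f {R : Type*} [CommRing R] (n : ℕ) : ((f R).comp^[n] X).eval 0 = 0 := by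
  induction n with
  | zero => simp
  | succ n ih => rw [Function.iterate_succ_apply', eval_comp, ih, eval_f]; ring

lemma natDegree_iterSub_of_isDomain {R : Type*} [CommRing R] [IsDomain R] [CharZero R] (n : ℕ)
    (x : R) : (iterSub n x).natDegree = 3 ^ n := by
  have : CharZero (FractionRing R) := IsFractionRing.charZero_of_isFractionRing (R := R)
  rw [← natDegree_map_eq_of_injective (IsFractionRing.injective R (FractionRing R)), map_iterSub,
    natDegree_iterSub]

lemma coeff_sub_mem {R : Type*} [CommRing R] {I : Ideal R} (h3 : (3 : R) ∈ I) {x : R} (hx : x ∈ I)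
    (n i : ℕ) : (iterSub n x).coeff i - (X ^ 3 ^ n : R[X]).coeff i ∈ I := by
  rw [← Ideal.Quotient.eq_zero_iff_mem, map_sub, ← coeff_map, ← coeff_map, map_iterSub,
    Ideal.Quotient.eq_zero_iff_mem.2 hx, iterSub, iterate_f_of_three]
  · simp
  · rw [← map_ofNat (Ideal.Quotient.mk I) 3]
    exact Ideal.Quotient.eq_zero_iff_mem.2 h3

/-- Modulo `3`, `f` is `z³`, so `f^n(z) - x` reduces to `z^(3^n)` modulo `I`. The constant term is
`-x`, because `0` is fixed by `f`. -/
lemma isEisensteinAt_iterSub {R : Type*} [CommRing R] [IsDomain R] [CharZero R] {I : Ideal R}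
    (hI : I ≠ ⊤) (h3 : (3 : R) ∈ I) {x : R} (hx : x ∈ I) (hx2 : x ∉ I ^ 2) (n : ℕ) :
    (iterSub n x).IsEisensteinAt I := by
  have hdeg := natDegree_iterSub_of_isDomain n x
  refine ⟨fun h => hI ?_, fun {i} hi => ?_, ?_⟩
  · have := coeff_sub_mem h3 hx n (3 ^ n)
    rw [coeff_X_pow_self] at this
    rw [leadingCoeff, hdeg] at h
    rw [Ideal.eq_top_iff_one]
    simpa using sub_mem h this
  · have := coeff_sub_mem h3 hx n i
    rw [hdeg] at hi
    rwa [coeff_X_pow, if_neg hi.ne, sub_zero] at this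
  · rw [coeff_zero_eq_eval_zero, iterSub, eval_sub, eval_C, eval_zero_iterate_f, zero_sub,
      neg_mem_iff]
    exact hx2

variable {K : Type u} [Field K]

lemma mem_maximalIdeal_valuationSubring {v : Valuation K ℤᵐ⁰} {a : v.valuationSubring} :
    a ∈ IsLocalRing.maximalIdeal v.valuationSubring ↔ v a < 1 := by
  rw [IsLocalRing.mem_maximalIdeal, mem_nonunits_iff, ← not_le, not_iff_not]
  constructor
  · intro h
    obtain ⟨b, hb⟩ := h.exists_right_inv
    have h1 : v a * v b = 1 := by
      rw [← map_mul, ← map_one v]; exact congrArg (fun c : v.valuationSubring => v c) hb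
    rw [← h1]
    calc v a * v b ≤ v a * 1 := mul_le_mul' le_rfl b.2
      _ = v a := mul_one _
  · intro h
    have h1 : v a = 1 := le_antisymm a.2 h
    have ha : (a : K) ≠ 0 := fun h0 => by rw [h0, map_zero] at h1; exact zero_ne_one h1
    have hinv : (a : K)⁻¹ ∈ v.valuationSubring := by
      rw [Valuation.mem_valuationSubring_iff, map_inv₀, h1, inv_one]
    exact IsUnit.of_mul_eq_one ⟨_, hinv⟩ (Subtype.ext (mul_inv_cancel₀ ha))

variable [NumberField K]

lemma isEisensteinAtPrime_iterSub {x : K} {q : HeightOneSpectrum (𝓞 K)}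
    (hq : (3 : 𝓞 K) ∈ q.asIdeal) (hx : HasOrd q x 1) (n : ℕ) :
    IsEisensteinAtPrime q (iterSub n x) := by
  set v := q.valuation K
  have hx1 : v x < 1 := by rw [hx, exp_lt_one]; decide
  refine ⟨iterSub n ⟨x, hx1.le⟩, map_iterSub _ _ _,
    isEisensteinAt_iterSub (IsLocalRing.maximalIdeal.isMaximal _).ne_top ?_ ?_ ?_ n⟩
  · exact mem_maximalIdeal_valuationSubring.2 (HeightOneSpectrum.valuation_lt_one_of_mem 3 hq)
  · exact mem_maximalIdeal_valuationSubring.2 hx1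
  · intro h
    have key : ∀ a ∈ IsLocalRing.maximalIdeal v.valuationSubring ^ 2, v a ≤ exp (-2) := by
      intro a ha
      rw [pow_two] at ha
      refine Submodule.mul_induction_on ha (fun b hb c hc => ?_) fun b c hb hc => ?_
      · have := mul_le_mul' (le_exp_neg_one (mem_maximalIdeal_valuationSubring.1 hb))
          (le_exp_neg_one (mem_maximalIdeal_valuationSubring.1 hc))
        rwa [← map_mul, exp_mul] at this
      · exact v.map_add_le hb hc
    have := key _ h
    change v x ≤ _ at this
    rw [hx, exp_le_exp] at this
    norm_num at this

/-- The leading coefficient is outside the maximal ideal of a local ring, hence a unit, so the model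
is primitive without being monic and Gauss's lemma applies. -/
lemma IsEisensteinAtPrime.irreducible {q : HeightOneSpectrum (𝓞 K)} {g : K[X]}
    (h : IsEisensteinAtPrime q g) (hg : 0 < g.natDegree) : Irreducible g := by
  obtain ⟨G, rfl, hG⟩ := h
  have hdeg : (G.map (algebraMap (q.valuation K).valuationSubring K)).natDegree = G.natDegree :=
    natDegree_map_eq_of_injective (IsFractionRing.injective _ _) _
  have hprim : G.IsPrimitive := by
    refine isPrimitive_iff_isUnit_of_C_dvd.2 fun r hr => ?_
    have hlead : IsUnit G.leadingCoeff := by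
      by_contra h
      exact hG.leading ((IsLocalRing.mem_maximalIdeal _).2 h)
    exact isUnit_of_dvd_unit (C_dvd_iff_dvd_coeff r G |>.1 hr _) hlead
  have := hG.irreducible (IsLocalRing.maximalIdeal.isMaximal _).isPrime hprim (hdeg ▸ hg)
  exact (hprim.irreducible_iff_irreducible_map_fraction_map (K := K)).1 this

end Eisenstein

end CubicPCF

/-! ### The Galois image is all of `E n` -/

lemma Equiv.Perm.exists_fixed_of_sign (b : Equiv.Perm (Fin 3)) (h : b.sign = -1) :
    ∃ j, b j = j := by
  revert b; decide

/-- A transposition is determined by its fixed point, so transitivity makes every transposition a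
conjugate of the given one by an element of `B`. -/
lemma Equiv.Perm.eq_top_of_transitive (B : Subgroup (Equiv.Perm (Fin 3)))
    (htrans : ∀ i j, ∃ b ∈ B, b i = j) (hodd : ∃ b ∈ B, b.sign = -1) : B = ⊤ := by
  obtain ⟨t, ht, hs⟩ := hodd
  have key : ∀ b : Equiv.Perm (Fin 3), b.sign = -1 → b ∈ B := by
    intro b hb
    obtain ⟨i, hi⟩ := t.exists_fixed_of_sign hs
    obtain ⟨j, hj⟩ := b.exists_fixed_of_sign hb
    obtain ⟨g, hg, hgij⟩ := htrans i j
    have h1 := TernaryTree.perm_three_mul b (g * t * g⁻¹) j hj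
      (by simp [← hgij, hi]) hb (by simp [hs])
    rw [mul_eq_one_iff_eq_inv] at h1
    rw [h1]
    exact B.inv_mem (B.mul_mem (B.mul_mem hg ht) (B.inv_mem hg))
  refine top_le_iff.1 fun b _ => ?_
  rcases Int.units_eq_one_or b.sign with h | h
  · have := B.mul_mem (key (b * t) (by simp [h, hs])) (B.inv_mem ht)
    rwa [mul_inv_cancel_right] at this
  · exact key b h

namespace CubicPCF

open TernaryTree TernaryTree.Vertex

section Image

variable (K : Type*) {Ω : Type*} [Field K] [Field Ω] [Algebra K Ω]

/-- The tree automorphisms that are induced by automorphisms of `Ω` over `K`. -/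
def galImage {n : ℕ} (lab : Vertex n → Ω) : Subgroup (treeAut n) where
  carrier := {a | ∃ s : Ω ≃ₐ[K] Ω, ∀ w, lab (a.1 w) = s (lab w)}
  mul_mem' := by
    rintro a a' ⟨s, hs⟩ ⟨s', hs'⟩
    exact ⟨s * s', fun w => (hs _).trans (congrArg s (hs' w))⟩
  one_mem' := ⟨1, fun _ => rfl⟩
  inv_mem' := by
    rintro a ⟨s, hs⟩
    refine ⟨s⁻¹, fun w => s.injective ?_⟩
    rw [← hs]
    exact (congrArg lab (a.1.apply_symm_apply w)).trans (s.apply_symm_apply _).symm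

variable {K}

lemma treeAut_ext_of_lab {n : ℕ} {lab : Vertex n → Ω} (h : IsOriented n lab) {a a' : treeAut n}
    (haa : ∀ w, lab (a.1 w) = lab (a'.1 w)) : a = a' :=
  Subtype.ext (Equiv.ext fun w => eq_of_level_eq h
    ((level_treeAut a w).trans (level_treeAut a' w).symm) (haa w))

variable [CharZero Ω]

lemma exists_treeAut_of_algEquiv {n : ℕ} {lab : Vertex n → Ω} (h : IsOriented n lab) {x : K}
    (hx : lab (root n) = algebraMap K Ω x) (s : Ω ≃ₐ[K] Ω) :
    ∃ a ∈ E n, ∀ w, lab (a.1 w) = s (lab w) :=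
  exists_treeAut h h s.toRingEquiv (by rw [hx]; exact s.commutes x)

lemma galImage_le {n : ℕ} {lab : Vertex n → Ω} (h : IsOriented n lab) {x : K}
    (hx : lab (root n) = algebraMap K Ω x) : galImage K lab ≤ E n := by
  rintro a ⟨s, hs⟩
  obtain ⟨a', ha', hs'⟩ := exists_treeAut_of_algEquiv h hx s
  rwa [treeAut_ext_of_lab h fun w => (hs w).trans (hs' w).symm]

end Image

lemma iterate_eq_of_aeval {K L : Type*} [CommRing K] [CommRing L] [Algebra K L] {n : ℕ} {x : K}
    {y : L} (h : aeval y (iterSub n x) = 0) :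
    (fun z => (f L).eval z)^[n] y = algebraMap K L x := by
  rw [aeval_def, eval₂_eq_eval_map, map_iterSub, iterSub, eval_sub, eval_C, sub_eq_zero,
    iterate_comp_eval, eval_X] at h
  exact h

section Surjective

variable {K Ω : Type u} [Field K] [NumberField K] [Field Ω] [NumberField Ω] [Algebra K Ω]

lemma exists_algEquiv_ne [IsGalois K Ω] {w : Ω} {d : K} (hw : w ^ 2 = algebraMap K Ω d)
    (hd : ¬ IsSquare d) : ∃ s : Ω ≃ₐ[K] Ω, s w ≠ w := by
  by_contra! h
  obtain ⟨u, hu⟩ := (IsGalois.mem_range_algebraMap_iff_fixed w).2 h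
  refine hd ⟨u, (algebraMap K Ω).injective ?_⟩
  rw [← hw, ← hu, map_mul, pow_two]

/-- Irreducibility of `f(z) - x` gives transitivity on the fibre. An odd permutation exists because
`2/3` times the Vandermonde determinant is a square root of the nonsquare `3x(1-x)`. -/
lemma exists_join_mem_galImage [IsGalois K Ω] {x : K} (hx : IsAdmissible x) {n : ℕ}
    {lab : Vertex (n + 1) → Ω} (hlab : IsOriented (n + 1) lab)
    (hroot : lab (root (n + 1)) = algebraMap K Ω x) (b : Equiv.Perm (Fin 3)) :
    ∃ a, join a b ∈ galImage K lab := by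
  have hy := hlab.isFibre
  rw [hroot] at hy
  let B : Subgroup (Equiv.Perm (Fin 3)) :=
    { carrier := {b | ∃ a, join a b ∈ galImage K lab}
      mul_mem' := by
        rintro b b' ⟨a, ha⟩ ⟨a', ha'⟩
        have := mul_mem ha ha'
        rw [join_mul] at this
        exact ⟨_, this⟩
      one_mem' := ⟨_, by rw [join_one]; exact one_mem _⟩
      inv_mem' := by
        rintro b ⟨a, ha⟩
        have := inv_mem ha
        rw [join_inv] at this
        exact ⟨_, this⟩ }
  have hB : ∀ s : Ω ≃ₐ[K] Ω, ∃ b ∈ B, (∀ i, s (child lab i) = child lab (b i)) ∧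
      s (vdm (child lab)) = ((b.sign : ℤ) : Ω) * vdm (child lab) := by
    intro s
    obtain ⟨c, -, hc⟩ := exists_treeAut_of_algEquiv hlab hroot s
    obtain ⟨a, b, rfl⟩ := exists_eq_join c
    refine ⟨b, ⟨a, s, hc⟩, fun i => ?_, ?_⟩
    · rw [child, ← hc, join_apply_cons, treeAut_root]; rfl
    · have := map_vdm_child s.toRingEquiv _ hc
      rwa [sgnOne_join] at this
  have htop : B = ⊤ := by
    refine Equiv.Perm.eq_top_of_transitive B (fun i j => ?_) ?_
    · obtain ⟨q, hq, hxq⟩ := hx.2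
      have hirr : Irreducible (iterSub 1 x) :=
        (isEisensteinAtPrime_iterSub hq hxq 1).irreducible (by
          rw [natDegree_iterSub]; norm_num)
      have haeval : ∀ i, aeval (child lab i) (iterSub 1 x) = 0 := fun i => by
        rw [aeval_def, eval₂_eq_eval_map, map_iterSub, iterSub, ← hy.eval i]
        simp
      have hint : IsIntegral K (child lab i) := Algebra.IsIntegral.isIntegral _
      have hdvd : iterSub 1 x ∣ minpoly K (child lab i) :=
        (minpoly.irreducible hint).dvd_symm hirr (minpoly.dvd K _ (haeval i))
      obtain ⟨s, hs⟩ := minpoly.exists_algEquiv_of_root' (K := K) (x := child lab j) (y := child lab i)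
        hint.isAlgebraic (by
          obtain ⟨g, hg⟩ := hdvd
          rw [hg, map_mul, haeval, zero_mul])
      obtain ⟨b, hb, hbs, -⟩ := hB s
      exact ⟨b, hb, hy.injective ((hbs i).symm.trans hs)⟩
    · obtain ⟨s, hs⟩ := exists_algEquiv_ne (K := K) (w := 2 / 3 * vdm (child lab))
        (d := 3 * (x * (1 - x))) (by
          have := hy.vdm_sq
          simp only [map_mul, map_sub, map_one, map_ofNat]
          linear_combination this / 9) hx.not_isSquare_discr
      obtain ⟨b, hb, -, hbs⟩ := hB s
      refine ⟨b, hb, Int.units_ne_one_iff.1 fun h => hs ?_⟩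
      rw [map_mul, hbs, h]
      simp [map_ofNat s]
  exact (htop ▸ Subgroup.mem_top b : b ∈ B)

/-- Induction with `Ω` fixed and the base field enlarged to `F = K(y j)`, whose Galois group fixes
the vertex `j`. The induction hypothesis for the subtree above `j` supplies the stabilizer condition
of `E_le_of_stabilizer`. -/
theorem E_le_galImage {n : ℕ} {K Ω : Type u} [Field K] [NumberField K] [Field Ω] [NumberField Ω]
    [Algebra K Ω] [IsGalois K Ω] {x : K} (hx : IsAdmissible x)
    {lab : Vertex n → Ω} (hlab : IsOriented n lab) (hroot : lab (root n) = algebraMap K Ω x) :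
    E n ≤ galImage K lab := by
  induction n generalizing K with
  | zero =>
    intro a _
    rw [Subsingleton.elim a 1]
    exact one_mem _
  | succ n ih =>
    cases n with
    | zero =>
      intro c _
      obtain ⟨a, b, rfl⟩ := exists_eq_join c
      obtain ⟨a', ha'⟩ := exists_join_mem_galImage hx hlab hroot b
      rwa [Subsingleton.elim a a']
    | succ n =>
      have hy := hlab.isFibre
      rw [hroot] at hy
      obtain ⟨j, hj⟩ := hx.exists_preimage hy
      let F := IntermediateField.adjoin K {child lab j}
      let z : F := IntermediateField.AdjoinSimple.gen K (child lab j)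
      have hz : (z : Ω) = child lab j := IntermediateField.AdjoinSimple.coe_gen K _
      have hint : IsIntegral K (child lab j) := Algebra.IsIntegral.isIntegral _
      have hfin : Module.finrank K F ≤ 3 := by
        rw [IntermediateField.adjoin.finrank hint, ← pow_one 3, ← natDegree_iterSub 1 x]
        refine natDegree_le_of_dvd (minpoly.dvd K _ ?_) fun h0 => ?_
        · rw [aeval_def, eval₂_eq_eval_map, map_iterSub, iterSub, ← hy.eval j]
          simp
        · have := natDegree_iterSub 1 x
          rw [h0] at this
          simp at this
      obtain ⟨hadm, hsq⟩ := hj F z hfin hz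
      have hfix : ∀ s : Ω ≃ₐ[F] Ω, ∃ a b, join a b ∈ galImage K lab ∧ b j = j ∧
          (∀ w, lab ((join a b).1 w) = s (lab w)) ∧
          ∀ w, subLab j lab ((a j).1 w) = s (subLab j lab w) := by
        intro s
        obtain ⟨c, -, hc⟩ := exists_treeAut_of_algEquiv hlab hroot (s.restrictScalars K)
        obtain ⟨a, b, rfl⟩ := exists_eq_join c
        have hbj : b j = j := by
          have h1 := hc (cons j (root _))
          rw [join_apply_cons, treeAut_root] at h1
          refine hy.injective (h1.trans ?_)
          change s (child lab j) = child lab j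
          rw [← hz]
          exact s.commutes z
        refine ⟨a, b, ⟨_, hc⟩, hbj, hc, fun w => ?_⟩
        have h1 := hc (cons j w)
        rw [join_apply_cons, hbj] at h1
        exact h1
      refine E_le_of_stabilizer (galImage_le hlab hroot) j (fun c hc => ?_)
        (exists_join_mem_galImage hx hlab hroot) ?_
      · obtain ⟨s, hs⟩ := ih hadm (hlab.sub j) hz.symm hc
        obtain ⟨a, b, hab, hb, -, ha⟩ := hfix s
        exact ⟨a, b, hab, hb, treeAut_ext_of_lab (hlab.sub j) fun w => (ha w).trans (hs w).symm⟩
      -- The element `w` is a square root of `x(1-x)y(1-y)` with `y = y j`. An automorphism over `F`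
      -- multiplies it by `b.sign * sgnOne n (a j)`, so moving `w` means that the two signs differ.
      · obtain ⟨s, hs⟩ := exists_algEquiv_ne (K := F)
          (w := 4 / 27 * (vdm (child lab) * vdm (child (subLab j lab)))) (by
            have h1 := hy.vdm_sq
            have h2 := (hlab.sub j).isFibre.vdm_sq
            have h3 : subLab j lab (root _) = child lab j := rfl
            have h4 : algebraMap F Ω (algebraMap K F x) = algebraMap K Ω x := rfl
            have h5 : algebraMap F Ω z = child lab j := hz
            simp only [map_mul, map_sub, map_one, h4, h5]
            rw [h3] at h2
            linear_combination (4 * vdm (child (subLab j lab)) ^ 2 * h1 +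
              27 * (algebraMap K Ω x * (1 - algebraMap K Ω x)) * h2) / 729) hsq
        obtain ⟨a, b, hab, hb, hs', ha⟩ := hfix s
        refine ⟨a, b, hab, hb, fun h => hs ?_⟩
        have e1 := map_vdm_child s.toRingEquiv _ hs'
        have e2 := map_vdm_child s.toRingEquiv _ ha
        rw [sgnOne_join, ← h] at e1
        have e1' : s (vdm (child lab)) = _ := e1
        have e2' : s (vdm (child (subLab j lab))) = _ := e2
        rw [map_mul, map_mul, e1', e2']
        rcases Int.units_eq_one_or (sgnOne n (a j)) with h | h <;> rw [h] <;> simp [map_ofNat s]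

/-- The action on labels is faithful because the leaf labels exhaust the roots; its image is `E n`
by the two inclusions. -/
theorem exists_labelling_gal {K : Type u} [Field K] [NumberField K] {x : K}
    (hx : IsAdmissible x) {n : ℕ} (hirr : Irreducible (iterSub n x)) :
    ∃ (lab : Vertex n → (iterSub n x).SplittingField) (e : (iterSub n x).Gal ≃* E n),
      IsTreeLabelling n (algebraMap K (iterSub n x).SplittingField x) lab ∧
      ∀ (s : (iterSub n x).Gal) (v : Vertex n), lab ((e s).1.1 v) = s (lab v) := by
  let Ω := (iterSub n x).SplittingField
  have : FiniteDimensional K Ω := IsSplittingField.finiteDimensional Ω (iterSub n x)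
  have : NumberField Ω := NumberField.of_module_finite K Ω
  have : IsGalois K Ω := IsGalois.of_separable_splitting_field hirr.separable
  -- Otherwise `3x(1-x) = 0` would be a square.
  have hx01 : algebraMap K Ω x * (1 - algebraMap K Ω x) ≠ 0 := by
    rw [← map_one (algebraMap K Ω), ← map_sub, ← map_mul]
    refine (_root_.map_ne_zero _).2 fun h => hx.not_isSquare_discr ⟨0, ?_⟩
    rw [h]; simp
  obtain ⟨lab, hroot, hlab⟩ := exists_isOriented n hx01 (by
    rw [← map_iterSub]
    exact SplittingField.splits _)
  choose c hcE hc using exists_treeAut_of_algEquiv (K := K) hlab hroot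
  have hmul : ∀ s t, c (s * t) = c s * c t := fun s t =>
    treeAut_ext_of_lab hlab fun w => by
      rw [hc]
      change s (t (lab w)) = lab ((c s).1 ((c t).1 w))
      rw [hc, hc]
  let φ : (iterSub n x).Gal →* E n := MonoidHom.mk' (fun s => ⟨c s, hcE s⟩)
    fun s t => Subtype.ext (hmul s t)
  have htree := isTreeLabelling hlab
  rw [hroot] at htree
  have hinj : Function.Injective φ := by
    intro s t hst
    refine Gal.ext _ fun y hy => ?_
    have hy' : (fun z => (f Ω).eval z)^[n] y = algebraMap K Ω x := by
      exact iterate_eq_of_aeval (mem_rootSet.1 hy).2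
    obtain ⟨v, -, rfl⟩ := (htree.bijOn n le_rfl).surjOn hy'
    have h1 : c s = c t := congrArg Subtype.val hst
    exact (hc s v).symm.trans ((congrArg (fun a : treeAut n => lab (a.1 v)) h1).trans (hc t v))
  have hsurj : Function.Surjective φ := by
    rintro ⟨a, ha⟩
    obtain ⟨s, hs⟩ := E_le_galImage hx hlab hroot ha
    exact ⟨s, Subtype.ext (treeAut_ext_of_lab hlab fun w => (hc s w).trans (hs w).symm)⟩
  exact ⟨lab, MulEquiv.ofBijective φ ⟨hinj, hsurj⟩, htree, fun s v => hc s v⟩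

end Surjective

end CubicPCF

/-! ### Orders of `E n` and `Aut(T_n)` -/

namespace TernaryTree

open Vertex

lemma card_treeAut_zero : Nat.card (treeAut 0) = 1 := Nat.card_unique

lemma card_treeAut_succ (n : ℕ) : Nat.card (treeAut (n + 1)) = 6 * Nat.card (treeAut n) ^ 3 := by
  have h : Function.Bijective
      (fun p : (Fin 3 → treeAut n) × Equiv.Perm (Fin 3) => join p.1 p.2) :=
    ⟨fun p q h => Prod.ext (join_injective h).1 (join_injective h).2, fun σ => by
      obtain ⟨a, b, rfl⟩ := exists_eq_join σ
      exact ⟨(a, b), rfl⟩⟩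
  rw [← Nat.card_congr (Equiv.ofBijective _ h), Nat.card_prod, Nat.card_perm, Nat.card_fun,
    Nat.card_fin, mul_comm]
  rfl

lemma card_E_zero : Nat.card (E 0) = 1 := Nat.card_unique

lemma card_E_one : Nat.card (E 1) = 6 := by
  have : Nat.card (E 1) = Nat.card (treeAut 1) := Nat.card_congr Subgroup.topEquiv.toEquiv
  rw [this, card_treeAut_succ, card_treeAut_zero, one_pow, mul_one]

/-- The three subtree automorphisms are free in `E (n + 1)`; they prescribe the sign of `b`, leaving
three choices. -/
lemma card_E_add_two (n : ℕ) : Nat.card (E (n + 2)) = 3 * Nat.card (E (n + 1)) ^ 3 := by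
  let P : (Fin 3 → E (n + 1)) → Equiv.Perm (Fin 3) → Prop :=
    fun a b => b.sign * ∏ i, sgnOne n (a i) = 1
  have h : Function.Bijective (fun p : (a : Fin 3 → E (n + 1)) × {b // P a b} =>
      (⟨join (fun i => (p.1 i).1) p.2.1, join_mem_E.2 ⟨fun i => (p.1 i).2, p.2.2⟩⟩ : E (n + 2))) := by
    constructor
    · rintro ⟨a, b, hb⟩ ⟨a', b', hb'⟩ h
      obtain ⟨h1, rfl⟩ := join_injective (congrArg Subtype.val h)
      obtain rfl : a = a' := funext fun i => Subtype.ext (congrFun h1 i)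
      rfl
    · rintro ⟨σ, hσ⟩
      obtain ⟨a, b, rfl⟩ := exists_eq_join σ
      obtain ⟨h1, h2⟩ := join_mem_E.1 hσ
      exact ⟨⟨fun i => ⟨a i, h1 i⟩, b, h2⟩, rfl⟩
  have hthree : ∀ u : ℤˣ, Nat.card {b : Equiv.Perm (Fin 3) // b.sign * u = 1} = 3 := by
    intro u
    rw [Nat.card_eq_fintype_card]
    revert u
    decide
  have := Fintype.ofFinite (Fin 3 → E (n + 1))
  rw [← Nat.card_congr (Equiv.ofBijective _ h), Nat.card_sigma]
  simp only [P, hthree]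
  rw [Finset.sum_const, smul_eq_mul, Finset.card_univ, ← Nat.card_eq_fintype_card, Nat.card_fun,
    Nat.card_fin, mul_comm]

lemma log_card_treeAut (n : ℕ) :
    2 * Real.log (Nat.card (treeAut n)) = (3 ^ n - 1) * Real.log 6 := by
  induction n with
  | zero => simp
  | succ n ih =>
    have h : ((Nat.card (treeAut n) : ℕ) : ℝ) ≠ 0 := Nat.cast_ne_zero.2 Nat.card_pos.ne'
    rw [card_treeAut_succ, Nat.cast_mul, Nat.cast_pow, Real.log_mul (by norm_num) (pow_ne_zero _ h),
      Real.log_pow]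
    push_cast
    linear_combination 3 * ih

lemma log_card_E (n : ℕ) : 2 * Real.log (Nat.card (E (n + 1))) =
    3 ^ n * (2 * Real.log 6 + Real.log 3) - Real.log 3 := by
  induction n with
  | zero => simp [card_E_one]
  | succ n ih =>
    have h : ((Nat.card (E (n + 1)) : ℕ) : ℝ) ≠ 0 := Nat.cast_ne_zero.2 Nat.card_pos.ne'
    rw [card_E_add_two, Nat.cast_mul, Nat.cast_pow, Real.log_mul (by norm_num) (pow_ne_zero _ h),
      Real.log_pow]
    push_cast
    linear_combination 3 * ih

lemma log_six : Real.log 6 = Real.log 2 + Real.log 3 := by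
  rw [← Real.log_mul (by norm_num) (by norm_num)]; norm_num

lemma log_six_pos : 0 < Real.log 6 := Real.log_pos (by norm_num)

theorem tendsto_log_card_div : Tendsto (fun n : ℕ => Real.log (Nat.card (E n)) /
    Real.log (Nat.card (treeAut n))) atTop (𝓝 (1 - 1 / 3 * (Real.log 2 / Real.log 6))) := by
  rw [← tendsto_add_atTop_iff_nat 1]
  have h6 := log_six_pos.ne'
  have hpow : Tendsto (fun n : ℕ => ((3 : ℝ)⁻¹) ^ n) atTop (𝓝 0) :=
    tendsto_pow_atTop_nhds_zero_of_lt_one (by norm_num) (by norm_num)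
  have hlim : Tendsto (fun n : ℕ => ((2 * Real.log 6 + Real.log 3) - Real.log 3 * (3 : ℝ)⁻¹ ^ n) /
      ((3 - (3 : ℝ)⁻¹ ^ n) * Real.log 6)) atTop
      (𝓝 (((2 * Real.log 6 + Real.log 3) - Real.log 3 * 0) / ((3 - 0) * Real.log 6))) :=
    (tendsto_const_nhds.sub (hpow.const_mul _)).div ((tendsto_const_nhds.sub hpow).mul_const _)
      (by simpa using h6)
  have hval : ((2 * Real.log 6 + Real.log 3) - Real.log 3 * 0) / ((3 - 0) * Real.log 6) =
      1 - 1 / 3 * (Real.log 2 / Real.log 6) := by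
    field_simp
    linear_combination -3 * log_six
  rw [hval] at hlim
  refine hlim.congr fun n => ?_
  have h3 : (0 : ℝ) < 3 ^ n := by positivity
  rw [← mul_div_mul_left (Real.log _) (Real.log _) (two_ne_zero' ℝ), log_card_E, log_card_treeAut,
    inv_pow, ← mul_div_mul_left _ _ h3.ne']
  congr 1
  · field_simp
  · rw [pow_succ]; field_simp

/-! ### Hausdorff dimension of `E_∞` -/

/-- The Hausdorff dimension of `E_∞`. -/
noncomputable def dimE : ℝ := 1 - 1 / 3 * (Real.log 2 / Real.log 6)

lemma dimE_pos : 0 < dimE := by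
  have h : Real.log 2 / Real.log 6 ≤ 1 := by
    rw [div_le_one log_six_pos]
    exact Real.log_le_log (by norm_num) (by norm_num)
  rw [dimE]
  linarith

/-- The error term is bounded, in fact constant. This makes the Hausdorff measure in dimension
`dimE` comparable with counting cylinders, up to the factors `1` and `2` used below. -/
lemma log_card_E_eq (n : ℕ) : Real.log (Nat.card (E (n + 1))) =
    dimE * Real.log (Nat.card (treeAut (n + 1))) + Real.log 2 / 3 := by
  have h1 := log_card_E n
  have h2 := log_card_treeAut (n + 1)
  have h3 : dimE * Real.log 6 = Real.log 6 - Real.log 2 / 3 := by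
    rw [dimE]; field_simp [log_six_pos.ne']
  rw [pow_succ] at h2
  linear_combination h1 / 2 - dimE / 2 * h2 - (3 ^ n * 3 - 1) / 2 * h3 -
    (3 ^ n - 1) / 2 * log_six

lemma card_treeAut_rpow_le (n : ℕ) : (Nat.card (treeAut n) : ℝ) ^ dimE ≤ Nat.card (E n) := by
  cases n with
  | zero => rw [card_treeAut_zero, card_E_zero]; norm_num
  | succ n =>
    have hA : (0 : ℝ) < Nat.card (treeAut (n + 1)) := Nat.cast_pos.2 Nat.card_pos
    have hE : (0 : ℝ) < Nat.card (E (n + 1)) := Nat.cast_pos.2 Nat.card_pos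
    rw [← Real.log_le_log_iff (Real.rpow_pos_of_pos hA _) hE, Real.log_rpow hA, log_card_E_eq]
    have := Real.log_pos (one_lt_two)
    linarith

lemma card_E_le (n : ℕ) : (Nat.card (E n) : ℝ) ≤ 2 * (Nat.card (treeAut n) : ℝ) ^ dimE := by
  cases n with
  | zero => rw [card_treeAut_zero, card_E_zero]; norm_num
  | succ n =>
    have hA : (0 : ℝ) < Nat.card (treeAut (n + 1)) := Nat.cast_pos.2 Nat.card_pos
    have hE : (0 : ℝ) < Nat.card (E (n + 1)) := Nat.cast_pos.2 Nat.card_pos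
    have hr := Real.rpow_pos_of_pos hA dimE
    rw [← Real.log_le_log_iff hE (by positivity), Real.log_mul two_ne_zero hr.ne',
      Real.log_rpow hA, log_card_E_eq]
    have := Real.log_pos (one_lt_two)
    linarith

/-- For `n ≥ 2` the sign condition involves only levels one and two, which restriction keeps, so one
may lift in each subtree separately. From `E 2` to `E 1` the lift is `exists_join_mem_E`. -/
lemma E_restrict (n : ℕ) :
    (∀ σ ∈ E (n + 1), restrict n.le_succ σ ∈ E n) ∧
      ∀ x ∈ E n, ∃ τ ∈ E (n + 1), restrict n.le_succ τ = x := by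
  induction n with
  | zero => exact ⟨fun _ _ => Subgroup.mem_top _, fun x _ => ⟨1, one_mem _, Subsingleton.elim _ _⟩⟩
  | succ n ih =>
    have hr : ∀ (a : Fin 3 → treeAut (n + 1)) (b), restrict (n + 1).le_succ (join a b) =
        join (fun i => restrict n.le_succ (a i)) b := fun a b => restrict_join _ a b
    cases n with
    | zero =>
      refine ⟨fun _ _ => Subgroup.mem_top _, fun x _ => ?_⟩
      obtain ⟨c, b, rfl⟩ := exists_eq_join x
      obtain ⟨a, ha⟩ := exists_join_mem_E 0 b
      refine ⟨_, ha, (hr a b).trans ?_⟩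
      congr 1
      exact Subsingleton.elim _ _
    | succ n =>
      constructor
      · intro σ hσ
        obtain ⟨a, b, rfl⟩ := exists_eq_join σ
        obtain ⟨h1, h2⟩ := join_mem_E.1 hσ
        rw [hr]
        exact join_mem_E.2 ⟨fun i => ih.1 _ (h1 i), h2⟩
      · intro x hx
        obtain ⟨a, b, rfl⟩ := exists_eq_join x
        obtain ⟨h1, h2⟩ := join_mem_E.1 hx
        choose c hc hca using fun i => ih.2 _ (h1 i)
        obtain rfl : (fun i => restrict (n + 1).le_succ (c i)) = a := funext hca
        exact ⟨join c b, join_mem_E.2 ⟨hc, h2⟩, hr c b⟩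

/-- The restriction homomorphism `E_{n+1} → E_n`. -/
noncomputable def restrictE (n : ℕ) : E (n + 1) →* E n :=
  ((restrict n.le_succ).comp (E (n + 1)).subtype).codRestrict (E n)
    fun σ => (E_restrict n).1 σ.1 σ.2

lemma restrictE_surjective (n : ℕ) : Function.Surjective (restrictE n) := fun x => by
  obtain ⟨τ, hτ, h⟩ := (E_restrict n).2 x.1 x.2
  exact ⟨⟨τ, hτ⟩, Subtype.ext h⟩

/-- The restriction homomorphism `E_∞ → E_n`. -/
noncomputable def projE (n : ℕ) : EInf →* E n :=
  ((proj n).comp EInf.subtype).codRestrict (E n) fun σ => (Subgroup.mem_iInf.1 σ.2 n :)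

lemma restrictE_projE (n : ℕ) (σ : EInf) : restrictE n (projE (n + 1) σ) = projE n σ :=
  Subtype.ext (proj_restrict σ.1 n.le_succ)

lemma exists_projE_eq (s : ∀ n, E n) (hs : ∀ n, restrictE n (s (n + 1)) = s n) :
    ∃ σ : EInf, ∀ n, projE n σ = s n := by
  have h : ∀ m n (h : m ≤ n), restrict h (s n).1 = (s m).1 := by
    intro m n h
    induction n, h using Nat.le_induction with
    | base => rfl
    | succ n hn ih => rw [← ih, ← hs n]; rfl
  exact ⟨⟨(⟨fun n => (s n).1, h⟩ : compatibleFamilies),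
    Subgroup.mem_iInf.2 fun n => (s n).2⟩, fun n => rfl⟩

/-- The number of extensions to `E_{n+1}` of an element of `E_n`. -/
noncomputable def kerCard (n : ℕ) : ℕ := Nat.card (restrictE n).ker

lemma kerCard_pos (n : ℕ) : 0 < kerCard n := Nat.card_pos

lemma card_E_succ (n : ℕ) : Nat.card (E (n + 1)) = Nat.card (E n) * kerCard n := by
  rw [Subgroup.card_eq_card_quotient_mul_card_subgroup (restrictE n).ker, kerCard,
    Nat.card_congr (QuotientGroup.quotientKerEquivOfSurjective _ (restrictE_surjective n)).toEquiv]

/-- A set-theoretic section identifies each fibre of `restrictE n` with its kernel, which is then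
numbered. -/
lemma exists_index (n : ℕ) : ∃ idx : E (n + 1) → Fin (kerCard n),
    ∀ x j, ∃ τ, restrictE n τ = x ∧ idx τ = j := by
  let e : (restrictE n).ker ≃ Fin (kerCard n) := Finite.equivFin _
  let s := Function.surjInv (restrictE_surjective n)
  have hs : ∀ x, restrictE n (s x) = x := Function.surjInv_eq _
  refine ⟨fun τ => e ⟨(s (restrictE n τ))⁻¹ * τ, by
    rw [MonoidHom.mem_ker, map_mul, map_inv, hs, inv_mul_cancel]⟩, fun x j =>
    ⟨s x * (e.symm j).1, ?_⟩⟩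
  have hx : restrictE n (s x * (e.symm j).1) = x := by
    rw [map_mul, hs, MonoidHom.mem_ker.1 (e.symm j).2, mul_one]
  refine ⟨hx, ?_⟩
  rw [← Equiv.eq_symm_apply]
  refine Subtype.ext ?_
  change (s (restrictE n (s x * (e.symm j).1)))⁻¹ * (s x * (e.symm j).1) = _
  rw [hx, inv_mul_cancel_left]

/-- A numbering of the extensions to `E_{n+1}` of an element of `E_n`. -/
noncomputable def index (n : ℕ) : E (n + 1) → Fin (kerCard n) := (exists_index n).choose

lemma exists_index_eq (n : ℕ) (x : E n) (j : Fin (kerCard n)) :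
    ∃ τ, restrictE n τ = x ∧ index n τ = j := (exists_index n).choose_spec x j

/-- A numbering of `E_n` that is compatible with restriction in the lexicographic sense. -/
noncomputable def rank : ∀ n, E n → ℕ
  | 0, _ => 0
  | n + 1, τ => rank n (restrictE n τ) * kerCard n + index n τ

/-- The left end of the subinterval of `[0, 1]` attached to the restriction of `σ` to `T_n`. -/
noncomputable def lowerEnd (σ : EInf) (n : ℕ) : ℝ := rank n (projE n σ) / Nat.card (E n)

/-- The right end of the subinterval of `[0, 1]` attached to the restriction of `σ` to `T_n`. -/
noncomputable def upperEnd (σ : EInf) (n : ℕ) : ℝ := (rank n (projE n σ) + 1) / Nat.card (E n)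

lemma card_E_pos (n : ℕ) : (0 : ℝ) < Nat.card (E n) := Nat.cast_pos.2 Nat.card_pos

lemma lowerEnd_monotone (σ : EInf) : Monotone (lowerEnd σ) := by
  refine monotone_nat_of_le_succ fun n => ?_
  have hk : (0 : ℝ) < kerCard n := Nat.cast_pos.2 (kerCard_pos n)
  rw [lowerEnd, lowerEnd, card_E_succ, rank, restrictE_projE, Nat.cast_mul,
    ← mul_div_mul_right _ _ hk.ne']
  have := (card_E_pos n)
  gcongr
  push_cast
  linarith [Nat.cast_nonneg (α := ℝ) (index n (projE (n + 1) σ)).1]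

lemma upperEnd_antitone (σ : EInf) : Antitone (upperEnd σ) := by
  refine antitone_nat_of_succ_le fun n => ?_
  have hk : (0 : ℝ) < kerCard n := Nat.cast_pos.2 (kerCard_pos n)
  rw [upperEnd, upperEnd, card_E_succ, rank, restrictE_projE, Nat.cast_mul,
    ← mul_div_mul_right (_ + 1) (Nat.card (E n) : ℝ) hk.ne']
  have := (card_E_pos n)
  gcongr
  have hi : ((index n (projE (n + 1) σ)).1 : ℝ) + 1 ≤ kerCard n := by
    exact_mod_cast (index n (projE (n + 1) σ)).2
  push_cast
  linarith

/-- The map `E_∞ → [0, 1]` given by the nested subintervals attached to the numberings of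
the groups `E_n`. -/
noncomputable def toInterval (σ : EInf) : ℝ := ⨆ n, lowerEnd σ n

lemma toInterval_mem (σ : EInf) (n : ℕ) :
    toInterval σ ∈ Set.Icc (lowerEnd σ n) (upperEnd σ n) := by
  refine Set.mem_iInter.1 (Monotone.ciSup_mem_iInter_Icc_of_antitone (lowerEnd_monotone σ)
    (upperEnd_antitone σ) fun n => ?_) n
  have := card_E_pos n
  rw [lowerEnd, upperEnd]
  gcongr
  linarith

lemma upperEnd_eq (σ : EInf) (n : ℕ) :
    upperEnd σ n = lowerEnd σ n + (Nat.card (E n) : ℝ)⁻¹ := by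
  rw [upperEnd, lowerEnd, add_div, one_div]

lemma le_card_E (n : ℕ) : n < Nat.card (E n) := by
  induction n with
  | zero => exact Nat.card_pos
  | succ n ih =>
    cases n with
    | zero => rw [card_E_one]; norm_num
    | succ n =>
      rw [card_E_add_two]
      have : Nat.card (E (n + 1)) ≤ Nat.card (E (n + 1)) ^ 3 := Nat.le_self_pow (by norm_num) _
      omega

lemma eq_of_forall_abs_sub_le {s t : ℝ} (h : ∀ n, |s - t| ≤ (Nat.card (E n) : ℝ)⁻¹) : s = t := by
  by_contra hne
  obtain ⟨n, hn⟩ := exists_nat_one_div_lt (abs_pos.2 (sub_ne_zero.2 hne))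
  refine (hn.trans_le (h n)).not_ge ?_
  rw [one_div]
  have : ((n : ℝ) + 1) ≤ Nat.card (E n) := by exact_mod_cast le_card_E n
  gcongr

/-- At stage `n`, `t` lies in the interval of rank `⌊t * |E n|⌋`. Integer division by `kerCard n`
turns the rank at stage `n + 1` into the one at stage `n`, so compatible elements with these ranks
can be chosen recursively. -/
lemma Ico_subset_range_toInterval : Set.Ico (0 : ℝ) 1 ⊆ Set.range toInterval := by
  rintro t ⟨h0, h1⟩
  let m : ℕ → ℕ := fun n => ⌊t * Nat.card (E n)⌋₊
  have hm : ∀ n, m (n + 1) / kerCard n = m n := fun n => by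
    have hk : (kerCard n : ℝ) ≠ 0 := Nat.cast_ne_zero.2 (kerCard_pos n).ne'
    rw [← Nat.floor_div_natCast]
    simp only [m]
    rw [card_E_succ, Nat.cast_mul, ← mul_assoc, mul_div_cancel_right₀ _ hk]
  have hstep : ∀ n (x : {x : E n // rank n x = m n}), ∃ y : {y : E (n + 1) // rank (n + 1) y = m (n + 1)},
      restrictE n y.1 = x.1 := by
    rintro n ⟨x, hx⟩
    obtain ⟨τ, h1, h2⟩ := exists_index_eq n x ⟨m (n + 1) % kerCard n, Nat.mod_lt _ (kerCard_pos n)⟩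
    refine ⟨⟨τ, ?_⟩, h1⟩
    rw [rank, h1, h2, hx, ← hm n]
    exact Nat.div_add_mod' _ _
  choose next hnext using hstep
  let s : ∀ n, {x : E n // rank n x = m n} := fun n => Nat.rec ⟨1, by
    have : m 0 = 0 := by
      simp only [m, card_E_zero, Nat.cast_one, mul_one, Nat.floor_eq_zero, h1]
    rw [this, rank]⟩ next n
  obtain ⟨σ, hσ⟩ := exists_projE_eq (fun n => (s n).1) (fun n => hnext n (s n))
  refine ⟨σ, eq_of_forall_abs_sub_le fun n => ?_⟩
  have hc := card_E_pos n
  have ha := toInterval_mem σ n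
  have hr : rank n (projE n σ) = m n := by rw [hσ, (s n).2]
  have hl : lowerEnd σ n ≤ t := by
    rw [lowerEnd, hr, div_le_iff₀ hc]
    exact Nat.floor_le (by positivity)
  have hu : t ≤ upperEnd σ n := by
    rw [upperEnd, hr, le_div_iff₀ hc]
    exact (Nat.lt_floor_add_one _).le
  rw [upperEnd_eq] at ha hu
  rw [abs_le]
  exact ⟨by linarith [ha.1], by linarith [ha.2]⟩

lemma ofReal_dimE : ENNReal.ofReal dimE = (dimE.toNNReal : ℝ≥0∞) := rfl

lemma coe_toNNReal_dimE : (dimE.toNNReal : ℝ) = dimE := Real.coe_toNNReal _ dimE_pos.le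

/-- Elements that agree on `T_n` land in a common interval of length `1/|E n|`, which is at most
`|Aut(T_n)|^(-dimE)`. -/
lemma holderWith_toInterval : HolderWith 1 dimE.toNNReal toInterval := by
  intro σ τ
  rw [ENNReal.coe_one, one_mul, coe_toNNReal_dimE, ← ENNReal.rpow_inv_le_iff dimE_pos]
  refine le_iInf₂ fun n hn => ?_
  rw [ENNReal.rpow_inv_le_iff dimE_pos]
  have hp : projE n σ = projE n τ := Subtype.ext hn
  have hA : (0 : ℝ) < Nat.card (treeAut n) := Nat.cast_pos.2 Nat.card_pos
  have h1 := toInterval_mem σ n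
  have h2 := toInterval_mem τ n
  have h3 : lowerEnd σ n = lowerEnd τ n := by rw [lowerEnd, lowerEnd, hp]
  rw [upperEnd_eq] at h1 h2
  have h4 : dist (toInterval σ) (toInterval τ) ≤ (Nat.card (E n) : ℝ)⁻¹ := by
    rw [Real.dist_eq, abs_le]
    exact ⟨by linarith [h1.1, h2.2], by linarith [h1.2, h2.1]⟩
  have h5 : (Nat.card (E n) : ℝ)⁻¹ ≤ ((Nat.card (treeAut n) : ℝ)⁻¹) ^ dimE := by
    rw [Real.inv_rpow hA.le]
    have := Real.rpow_pos_of_pos hA dimE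
    have := card_treeAut_rpow_le n
    gcongr
  rw [edist_dist, ← ENNReal.ofReal_natCast, ← ENNReal.ofReal_inv_of_pos hA,
    ENNReal.ofReal_rpow_of_pos (inv_pos.2 hA)]
  exact ENNReal.ofReal_le_ofReal (h4.trans h5)

/-- A Hölder map of exponent `dimE` divides dimension by at most `dimE`, and its range contains `[0,
1)`, of dimension `1`. -/
lemma ofReal_dimE_le_dimH : ENNReal.ofReal dimE ≤ dimH (EInf : Set TreeAutInf) := by
  have hd : 0 < dimE.toNNReal := Real.toNNReal_pos.2 dimE_pos
  have h1 : dimH (EInf : Set TreeAutInf) = dimH (Set.univ : Set EInf) := by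
    rw [← (isometry_subtype_coe (s := (EInf : Set TreeAutInf))).dimH_image, Set.image_univ,
      Subtype.range_coe]
  have h2 : (1 : ℝ≥0∞) ≤ dimH (Set.range toInterval) := by
    refine le_trans ?_ (dimH_mono Ico_subset_range_toInterval)
    rw [Real.dimH_of_nonempty_interior (by simp), Module.finrank_self, Nat.cast_one]
  have h3 := h2.trans (holderWith_toInterval.dimH_range_le hd)
  rw [h1, ofReal_dimE]
  rwa [ENNReal.le_div_iff_mul_le (Or.inl (by simpa using hd.ne')) (Or.inl ENNReal.coe_ne_top),
    one_mul] at h3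

lemma ediam_proj_fibre_le (n : ℕ) (i : treeAut n) :
    Metric.ediam {σ : TreeAutInf | proj n σ = i} ≤ ((Nat.card (treeAut n) : ℕ) : ℝ≥0∞)⁻¹ :=
  Metric.ediam_le fun σ hσ τ hτ => by
    have h : proj n σ = proj n τ := (show _ = i from hσ).trans (show _ = i from hτ).symm
    exact iInf₂_le n h

/-- The `|E n|` cylinders of level `n` have diameter at most `1/|Aut(T_n)|`, so they contribute at
most `|E n| * |Aut(T_n)|^(-dimE) ≤ 2` and the measure is finite. -/
lemma dimH_EInf_le : dimH (EInf : Set TreeAutInf) ≤ ENNReal.ofReal dimE := by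
  borelize TreeAutInf
  refine dimH_le_of_hausdorffMeasure_ne_top (d := dimE.toNNReal) (ne_top_of_le_ne_top
    (b := 2) (by simp) ?_)
  rw [coe_toNNReal_dimE]
  have hr : Tendsto (fun n => ((Nat.card (treeAut n) : ℕ) : ℝ≥0∞)⁻¹) atTop (𝓝 0) :=
    ENNReal.tendsto_inv_nat_nhds_zero.comp card_treeAut_strictMono.tendsto_atTop
  have := fun n => Fintype.ofFinite (E n)
  refine (MeasureTheory.Measure.hausdorffMeasure_le_liminf_sum dimE (EInf : Set TreeAutInf)
    (fun n => ((Nat.card (treeAut n) : ℕ) : ℝ≥0∞)⁻¹) hr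
    (fun n (i : E n) => {σ : TreeAutInf | proj n σ = i.1})
    (Eventually.of_forall fun n i => ediam_proj_fibre_le n i.1)
    (Eventually.of_forall fun n σ hσ => Set.mem_iUnion.2 ⟨projE n ⟨σ, hσ⟩, rfl⟩)).trans ?_
  refine (liminf_le_liminf (v := fun _ => (2 : ℝ≥0∞)) (Eventually.of_forall fun n => ?_)).trans
    (liminf_const _).le
  have hA : (0 : ℝ) < Nat.card (treeAut n) := Nat.cast_pos.2 Nat.card_pos
  have hA' := Real.rpow_pos_of_pos hA dimE
  calc _ ≤ ∑ _i : E n, (((Nat.card (treeAut n) : ℕ) : ℝ≥0∞)⁻¹) ^ dimE :=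
        Finset.sum_le_sum fun i _ =>
          ENNReal.rpow_le_rpow (ediam_proj_fibre_le n i.1) dimE_pos.le
    _ = ENNReal.ofReal (Nat.card (E n) * ((Nat.card (treeAut n) : ℝ)⁻¹) ^ dimE) := by
        rw [Finset.sum_const, Finset.card_univ, ← Nat.card_eq_fintype_card, nsmul_eq_mul,
          ENNReal.ofReal_mul (Nat.cast_nonneg _), ENNReal.ofReal_natCast,
          ← ENNReal.ofReal_rpow_of_pos (inv_pos.2 hA), ENNReal.ofReal_inv_of_pos hA,
          ENNReal.ofReal_natCast]
    _ ≤ ENNReal.ofReal 2 := by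
        refine ENNReal.ofReal_le_ofReal ?_
        rw [Real.inv_rpow hA.le, ← div_eq_mul_inv, div_le_iff₀ hA']
        exact card_E_le n
    _ = 2 := by simp

theorem dimH_EInf : dimH (EInf : Set TreeAutInf) = ENNReal.ofReal dimE :=
  le_antisymm dimH_EInf_le ofReal_dimE_le_dimH

end TernaryTree

theorem theorem1p1 :
    (∀ (K : Type u) [Field K] [NumberField K] (x : K)
        (p q : IsDedekindDomain.HeightOneSpectrum (𝓞 K)),
        (2 : 𝓞 K) ∈ p.asIdeal → (3 : 𝓞 K) ∈ q.asIdeal →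
        CubicPCF.HasOrd q x 1 →
        (CubicPCF.HasOrd p x 1 ∨ CubicPCF.HasOrd p x (-1) ∨ CubicPCF.HasOrd p (1 - x) 1) →
        ∀ n : ℕ, 1 ≤ n →
          Irreducible (CubicPCF.iterSub n x) ∧
          CubicPCF.IsEisensteinAtPrime q (CubicPCF.iterSub n x) ∧
          ∃ (lab : TernaryTree.Vertex n → (CubicPCF.iterSub n x).SplittingField)
            (e : (CubicPCF.iterSub n x).Gal ≃* TernaryTree.E n),
            CubicPCF.IsTreeLabelling n
              (algebraMap K (CubicPCF.iterSub n x).SplittingField x) lab ∧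
            ∀ (s : (CubicPCF.iterSub n x).Gal) (v : TernaryTree.Vertex n),
              lab ((e s).1.1 v) = s (lab v)) ∧
    Tendsto (fun n : ℕ => Real.log (Nat.card (TernaryTree.E n)) /
        Real.log (Nat.card (TernaryTree.treeAut n)))
      atTop (𝓝 (1 - 1 / 3 * (Real.log 2 / Real.log 6))) ∧
    dimH (TernaryTree.EInf : Set TernaryTree.TreeAutInf) =
      ENNReal.ofReal (1 - 1 / 3 * (Real.log 2 / Real.log 6)) := by
  refine ⟨fun K _ _ x p q hp hq hqx hpx n _ => ?_, TernaryTree.tendsto_log_card_div,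
    TernaryTree.dimH_EInf⟩
  have hadm : CubicPCF.IsAdmissible x := by
    refine ⟨⟨p, hp, ?_⟩, q, hq, hqx⟩
    rcases hpx with h | h | h
    · exact ⟨1, Or.inl rfl, Or.inl h⟩
    · exact ⟨-1, Or.inr rfl, Or.inl h⟩
    · exact ⟨1, Or.inl rfl, Or.inr h⟩
  have heis := CubicPCF.isEisensteinAtPrime_iterSub hq hqx n
  have hirr := heis.irreducible (by rw [CubicPCF.natDegree_iterSub]; positivity)
  exact ⟨hirr, heis, CubicPCF.exists_labelling_gal hadm hirr⟩
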